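/- Let $(M,g)$ be a smooth pseudo-Riemannian manifold with Levi-Civita connection $\nabla$, and let $S\to M$ be a real or complex spinor bundle or, more generally, any smooth vector bundle of finite rank over $\mathbb K\in\{\mathbb R,\mathbb C\}$ with a smooth $\mathbb K$-linear Clifford multiplication $\gamma:TM\otimes S\to S$, $\gamma(X)\gamma(Y)+\gamma(Y)\gamma(X)=-2g(X,Y)$, and a charge conjugation $C$, i.e. a smooth nondegenerate $\mathbb K$-bilinear form on $S$ with $C(\varphi,\psi)=\Delta_0C(\psi,\varphi)$ and $C(\varphi,\gamma(X)\psi)=\Delta_1C(\psi,\gamma(X)\varphi)$ for some signs $\Delta_0,\Delta_1\in\{\pm1\}$. Let $D$ be a smooth $\mathbb K$-linear connection on $S$ with curvature $R(X,Y)=D_XD_Y-D_YD_X-D_{[X,Y]}$. Let $D^C$ be the connection on $S$ determined by $X\big(C(\varphi,\psi)\big)=C(D_X\varphi,\psi)+C(\varphi,D^C_X\psi)$, put $(\hat D_X\gamma)(Y)\xi=D_X(\gamma(Y)\xi)-\gamma(\nabla_XY)\xi-\gamma(Y)D^C_X\xi$, and let the torsion of $D$ be $\mathcal T(X,Y)=(\hat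 D_X\gamma)(Y)-(\hat D_Y\gamma)(X)\in\mathrm{End}(S)$. The functions on the graded manifold $(M,\Gamma\Lambda S)$ are the smooth sections of $\Lambda S$ (exterior algebra over $\mathbb K$), and its vector fields are the graded derivations of $\Gamma\Lambda S$. For a vector field $X$ on $M$ let $\jmath_D(X)=D_X$, extended to $\Gamma\Lambda S$ as an even derivation which acts on functions on $M$ by $X$; an endomorphism of $S$ likewise acts on $\Gamma\Lambda S$ as an even derivation of degree zero that vanishes on functions on $M$. With a local frame $(e_\mu)$ of $TM$, its $g$-dual frame $(e^\mu)$, $g(e^\mu,e_\nu)=\delta^\mu_\nu$, and $\gamma^\mu=\gamma(e^\mu)$, $D^\nu=\jmath_D(e^\nu)$, $R_{\mu\nu}=R(e_\mu,e_\nu)$, $\mathcal T_{\mu\nu}=\mathcal T(e_\mu,e_\nu)$, set for $\varphi\in\Gamma S$ $$\imath(\varphi)=\gamma^\mu\varphi\otimes\jmath_D(e_\mu),\qquad\text{i.e.}\quad \imath(\varphi)f=\sum_\mu\gamma^\mu\varphi\wedge D_{e_\mu}f .$$ Let $\mathcal K\subset\{\eta\in\Gamma S: D^C\eta=0\}$ be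 a linear subspace such that $(\mathcal K,D)$ is admissible, i.e. $\big((\hat D_X\gamma)(Y)+(\hat D_Y\gamma)(X)\big)\eta=0$ for all $\eta\in\mathcal K$ and all $X,Y$. Then for all $\varphi,\psi\in\mathcal K$ the maps $\imath(\varphi),\imath(\psi)$ are odd vector fields on $(M,\Gamma\Lambda S)$, and their supercommutator $[\imath(\varphi),\imath(\psi)]=\imath(\varphi)\imath(\psi)+\imath(\psi)\imath(\varphi)$ is $$[\imath(\varphi),\imath(\psi)]=\mathfrak B(R;\varphi,\psi)+\tfrac12\,\mathfrak D(\mathcal T;\varphi,\psi),$$ where $$\mathfrak B(R;\varphi,\psi)=\gamma^\mu\varphi\wedge\gamma^\nu\psi\otimes R_{\mu\nu},\qquad \mathfrak D(\mathcal T;\varphi,\psi)=\big(\gamma^\mu\varphi\wedge\mathcal T_{\mu\nu}\psi+\gamma^\mu\psi\wedge\mathcal T_{\mu\nu}\varphi\big)\otimes D^\nu .$$ -/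

import Mathlib

open Bundle Module
open scoped Manifold ContDiff Topology

set_option linter.unusedSectionVars false

noncomputable section

namespace SpinorSuper

/-! ### Endomorphisms acting as derivations of the exterior algebra -/

section Algebra

variable {R : Type*} [CommRing R] {V : Type*} [AddCommGroup V] [Module R V]

/-- The algebra homomorphism from `Λ V` to the dual numbers over `Λ V` that extends
`v ↦ v + ε Φ(v)`. -/
def dualNumberLift (Φ : V →ₗ[R] V) :
    ExteriorAlgebra R V →ₐ[R] DualNumber (ExteriorAlgebra R V) :=
  ExteriorAlgebra.lift R
    ⟨{ toFun := fun v => TrivSqZeroExt.inl (ExteriorAlgebra.ι R v)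
          + TrivSqZeroExt.inr (ExteriorAlgebra.ι R (Φ v))
       map_add' := by
        intro v w
        ext <;> simp
       map_smul' := by
        intro c v
        ext <;> simp }, by
      intro v
      ext
      · simp
      · simp [ExteriorAlgebra.ι_add_mul_swap]⟩

/-- The derivation of degree zero of `Λ V` that extends the endomorphism `Φ` of `V`
(see `derivOfEnd_ι` and `derivOfEnd_mul`). -/
def derivOfEnd (Φ : V →ₗ[R] V) : ExteriorAlgebra R V →ₗ[R] ExteriorAlgebra R V :=
  (TrivSqZeroExt.sndHom (ExteriorAlgebra R V) (ExteriorAlgebra R V)).restrictScalars R ∘ₗ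
    (dualNumberLift Φ).toLinearMap

theorem dualNumberLift_ι (Φ : V →ₗ[R] V) (v : V) :
    dualNumberLift Φ (ExteriorAlgebra.ι R v) = TrivSqZeroExt.inl (ExteriorAlgebra.ι R v)
          + TrivSqZeroExt.inr (ExteriorAlgebra.ι R (Φ v)) := by
  simp [dualNumberLift]

theorem fst_dualNumberLift (Φ : V →ₗ[R] V) (a : ExteriorAlgebra R V) :
    (dualNumberLift Φ a).fst = a := by
  have h : (TrivSqZeroExt.fstHom R (ExteriorAlgebra R V) (ExteriorAlgebra R V)).comp
      (dualNumberLift Φ) = AlgHom.id R _ := by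
    apply ExteriorAlgebra.hom_ext
    ext v
    simp [dualNumberLift_ι]
  exact congrArg (fun f => f a) h

theorem derivOfEnd_ι (Φ : V →ₗ[R] V) (v : V) :
    derivOfEnd Φ (ExteriorAlgebra.ι R v) = ExteriorAlgebra.ι R (Φ v) := by
  simp [derivOfEnd, dualNumberLift_ι]

theorem derivOfEnd_mul (Φ : V →ₗ[R] V) (a b : ExteriorAlgebra R V) :
    derivOfEnd Φ (a * b) = derivOfEnd Φ a * b + a * derivOfEnd Φ b := by
  simp [derivOfEnd, fst_dualNumberLift, add_comm]

end Algebra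

/-! ### Pseudo-Riemannian metrics, Clifford multiplication, charge conjugation -/

variable (𝕜 : Type*) [RCLike 𝕜]
  {E : Type*} [NormedAddCommGroup E] [NormedSpace ℝ E]
  {H : Type*} [TopologicalSpace H] (I : ModelWithCorners ℝ E H)
  (M : Type*) [TopologicalSpace M] [ChartedSpace H M]

/-- A smooth pseudo-Riemannian metric of arbitrary signature. -/
structure PseudoRiemannianMetric [IsManifold I ∞ M] where
  /-- The bilinear form on each tangent space. -/
  val (x : M) : TangentSpace I x →L[ℝ] TangentSpace I x →L[ℝ] ℝ
  symm (x : M) (u v : TangentSpace I x) : val x u v = val x v u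
  nondegenerate (x : M) (u : TangentSpace I x) (hu : ∀ v, val x u v = 0) : u = 0
  contMDiff : ContMDiff I (I.prod 𝓘(ℝ, E →L[ℝ] E →L[ℝ] ℝ)) ∞
    (fun x ↦ TotalSpace.mk' (E →L[ℝ] E →L[ℝ] ℝ) x (val x))

variable {I M}

section Metric

variable [IsManifold I ∞ M] (g : PseudoRiemannianMetric I M)

/-- The metric at `x` as a bilinear form. -/
def PseudoRiemannianMetric.form (x : M) : LinearMap.BilinForm ℝ (TangentSpace I x) :=
  LinearMap.mk₂ ℝ (fun u v => g.val x u v) (by simp) (by simp) (by simp) (by simp)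

theorem PseudoRiemannianMetric.form_nondegenerate (x : M) : (g.form x).Nondegenerate := by
  refine ⟨fun u hu => g.nondegenerate x u hu, fun u hu => g.nondegenerate x u fun v => ?_⟩
  rw [g.symm]
  exact hu v

/-- The `g`-dual basis `e^μ` of a basis `e_μ` of a tangent space: `g(e^μ, e_ν) = δ^μ_ν`. -/
def PseudoRiemannianMetric.raise {ι : Type*} [Fintype ι] [DecidableEq ι] {x : M}
    (e : Basis ι ℝ (TangentSpace I x)) (μ : ι) : TangentSpace I x :=
  haveI : FiniteDimensional ℝ (TangentSpace I x) := e.finiteDimensional_of_finite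
  (g.form x).dualBasis (g.form_nondegenerate x) e μ

theorem PseudoRiemannianMetric.val_raise {ι : Type*} [Fintype ι] [DecidableEq ι] {x : M}
    (e : Basis ι ℝ (TangentSpace I x)) (μ ν : ι) :
    g.val x (g.raise e μ) (e ν) = if ν = μ then 1 else 0 :=
  haveI : FiniteDimensional ℝ (TangentSpace I x) := e.finiteDimensional_of_finite
  (g.form x).apply_dualBasis_left (g.form_nondegenerate x) e μ ν

/-- `nabla` is the Levi-Civita connection of `g`: torsion free and metric. The derivative
`∇_v Y` at `x` is written `nabla Y x v`. -/
structure IsLeviCivita (nabla : CovariantDerivative I E (TangentSpace I : M → Type _)) :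
    Prop where
  torsion_free : ∀ (x : M) (X Y : Π y : M, TangentSpace I y),
    MDifferentiableAt I (I.prod 𝓘(ℝ, E)) (fun y ↦ TotalSpace.mk' E y (X y)) x →
    MDifferentiableAt I (I.prod 𝓘(ℝ, E)) (fun y ↦ TotalSpace.mk' E y (Y y)) x →
    nabla Y x (X x) - nabla X x (Y x) = VectorField.mlieBracket I X Y x
  metric : ∀ (x : M) (v : TangentSpace I x) (Y Z : Π y : M, TangentSpace I y),
    MDifferentiableAt I (I.prod 𝓘(ℝ, E)) (fun y ↦ TotalSpace.mk' E y (Y y)) x →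
    MDifferentiableAt I (I.prod 𝓘(ℝ, E)) (fun y ↦ TotalSpace.mk' E y (Z y)) x →
    mvfderiv I (fun y => g.val y (Y y) (Z y)) x v
      = g.val x (nabla Y x v) (Z x) + g.val x (Y x) (nabla Z x v)

end Metric

variable (F : Type*) [NormedAddCommGroup F] [NormedSpace ℝ F] [NormedSpace 𝕜 F]
  (S : M → Type*) [TopologicalSpace (TotalSpace F S)]
  [∀ x, AddCommGroup (S x)] [∀ x, Module ℝ (S x)] [∀ x, Module 𝕜 (S x)]
  [∀ x, TopologicalSpace (S x)] [∀ x, IsTopologicalAddGroup (S x)]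
  [∀ x, ContinuousSMul ℝ (S x)]
  [FiberBundle F S] [VectorBundle ℝ F S] [VectorBundle 𝕜 F S]

section Spinor

variable [IsManifold I ∞ M] (g : PseudoRiemannianMetric I M)

/-- A smooth, `𝕜`-linear Clifford multiplication of `TM` on the bundle `S`,
with `XY + YX = -2 g(X, Y)`. -/
structure CliffordMultiplication where
  /-- `γ(u) : S_x → S_x` for `u ∈ T_x M`. -/
  val (x : M) : TangentSpace I x →L[ℝ] S x →L[ℝ] S x
  map_smul (x : M) (u : TangentSpace I x) (c : 𝕜) (s : S x) : val x u (c • s) = c • val x u s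
  clifford (x : M) (u v : TangentSpace I x) (s : S x) :
    val x u (val x v s) + val x v (val x u s) = (-2 * g.val x u v) • s
  contMDiff : ContMDiff I (I.prod 𝓘(ℝ, E →L[ℝ] F →L[ℝ] F)) ∞
    (fun x ↦ TotalSpace.mk' (E →L[ℝ] F →L[ℝ] F) x (val x))

variable {F S g} in
/-- A charge conjugation: a smooth, nondegenerate, `𝕜`-bilinear form `C` on `S` such that
`C(φ, ψ)` and `C(φ, γ(u) ψ)` have symmetries `Δ₀, Δ₁ ∈ {1, -1}` in `φ, ψ`. The two symmetries
together give `C(γ(u)φ, ψ) = Δ₀ Δ₁ C(φ, γ(u)ψ)`, hence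
`C(γ(u)γ(v)φ, ψ) = C(φ, γ(v)γ(u)ψ)`, which is the invariance under the spin group. -/
structure ChargeConjugation (γ : CliffordMultiplication 𝕜 F S g) where
  /-- The form on each fibre. -/
  val (x : M) : S x →L[ℝ] S x →L[ℝ] 𝕜
  map_smul_left (x : M) (c : 𝕜) (s t : S x) : val x (c • s) t = c * val x s t
  map_smul_right (x : M) (c : 𝕜) (s t : S x) : val x s (c • t) = c * val x s t
  nondegenerate (x : M) (s : S x) (hs : ∀ t, val x s t = 0) : s = 0
  exists_symm₀ : ∃ Δ₀ : ℤˣ, ∀ (x : M) (s t : S x), val x s t = ((Δ₀ : ℤ) : 𝕜) * val x t s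
  exists_symm₁ : ∃ Δ₁ : ℤˣ, ∀ (x : M) (u : TangentSpace I x) (s t : S x),
    val x s (γ.val x u t) = ((Δ₁ : ℤ) : 𝕜) * val x t (γ.val x u s)
  contMDiff : ContMDiff I (I.prod 𝓘(ℝ, F →L[ℝ] F →L[ℝ] 𝕜)) ∞
    (fun x ↦ TotalSpace.mk' (F →L[ℝ] F →L[ℝ] 𝕜) (E := fun x => S x →L[ℝ] S x →L[ℝ] 𝕜) x (val x))

variable (I) in
/-- A smooth `𝕜`-linear connection on `S`. The derivative `D_v σ` at `x` is written `D σ x v`;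
smoothness says that `D` maps sections that are smooth on an open set to smooth sections
of `T*M ⊗ S` on that set. -/
structure SpinorConnection extends CovariantDerivative I F S where
  map_smul : ∀ (x : M) (c : 𝕜) (σ : Π y : M, S y),
    MDifferentiableAt I (I.prod 𝓘(ℝ, F)) (fun y ↦ TotalSpace.mk' F y (σ y)) x →
    ∀ v : TangentSpace I x, toFun (c • σ) x v = c • toFun σ x v
  contMDiffOn : ∀ U : Set M, IsOpen U → ContMDiffCovariantDerivativeOn F ∞ toFun U

variable {𝕜 F S g}

/-- `DC` is the connection `D^C` associated with `D` and the charge conjugation `C`: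
`D ⊗ 1 + 1 ⊗ D^C` makes `C` parallel. As `C` is nondegenerate, this determines `D^C`. -/
def IsChargeAdjoint {γ : CliffordMultiplication 𝕜 F S g} (C : ChargeConjugation 𝕜 γ)
    (D DC : SpinorConnection 𝕜 I F S) : Prop :=
  ∀ (x : M) (v : TangentSpace I x) (σ τ : Π y : M, S y),
    MDifferentiableAt I (I.prod 𝓘(ℝ, F)) (fun y ↦ TotalSpace.mk' F y (σ y)) x →
    MDifferentiableAt I (I.prod 𝓘(ℝ, F)) (fun y ↦ TotalSpace.mk' F y (τ y)) x →
    mvfderiv I (fun y => C.val y (σ y) (τ y)) x v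
      = C.val x (D.toFun σ x v) (τ x) + C.val x (σ x) (DC.toFun τ x v)

end Spinor

/-! ### Endomorphism valued tensors: curvature, `D̂γ` and the torsion -/

section Tensors

/-- The local section of a vector bundle `W` through `s ∈ W_x` with constant coefficients in
the preferred trivialization at `x` (and zero where this trivialization is not defined). -/
def localExt (R : Type*) [NontriviallyNormedField R] {B : Type*} [TopologicalSpace B]
    (Z : Type*) [NormedAddCommGroup Z] [NormedSpace R Z] {W : B → Type*}
    [TopologicalSpace (TotalSpace Z W)] [∀ x, AddCommGroup (W x)] [∀ x, Module R (W x)]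
    [∀ x, TopologicalSpace (W x)] [FiberBundle Z W] [VectorBundle R Z W]
    {x : B} (s : W x) (y : B) : W y :=
  (trivializationAt Z W x).symmₗ R y ((trivializationAt Z W x).linearMapAt R x s)

section LocalExt

variable (R : Type*) [NontriviallyNormedField R] {B : Type*} [TopologicalSpace B]
    (Z : Type*) [NormedAddCommGroup Z] [NormedSpace R Z] {W : B → Type*}
    [TopologicalSpace (TotalSpace Z W)] [∀ x, AddCommGroup (W x)] [∀ x, Module R (W x)]
    [∀ x, TopologicalSpace (W x)] [FiberBundle Z W] [VectorBundle R Z W]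

theorem localExt_add {x : B} (s t : W x) :
    localExt R Z (s + t) = localExt R Z s + localExt R Z t := by
  funext y
  simp [localExt]

theorem localExt_smul {x : B} (c : R) (s : W x) :
    localExt R Z (c • s) = c • localExt R Z s := by
  funext y
  simp [localExt]

theorem localExt_eq_extend {x : B} (s : W x) {y : B} (hy : y ∈ (trivializationAt Z W x).baseSet) :
    localExt R Z s y = FiberBundle.extend Z s y := by
  rw [localExt, Trivialization.coe_symmₗ _ hy,
    Trivialization.coe_linearMapAt_of_mem _ (FiberBundle.mem_baseSet_trivializationAt' x)]
  rfl

theorem localExt_self {x : B} (s : W x) : localExt R Z s x = s := by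
  rw [localExt_eq_extend R Z s (FiberBundle.mem_baseSet_trivializationAt' x)]
  simp

end LocalExt

theorem exists_contMDiffOn_localExt (R : Type*) [NontriviallyNormedField R]
    (Z : Type*) [NormedAddCommGroup Z] [NormedSpace ℝ Z] [NormedSpace R Z] {W : M → Type*}
    [TopologicalSpace (TotalSpace Z W)] [∀ x, AddCommGroup (W x)] [∀ x, Module ℝ (W x)]
    [∀ x, Module R (W x)] [∀ x, TopologicalSpace (W x)] [FiberBundle Z W] [VectorBundle ℝ Z W]
    [VectorBundle R Z W] [ContMDiffVectorBundle ∞ Z W I] {x : M} (s : W x) :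
    ∃ U : Set M, IsOpen U ∧ x ∈ U ∧ ContMDiffOn I (I.prod 𝓘(ℝ, Z)) ∞
      (fun y ↦ TotalSpace.mk' Z y (localExt R Z s y)) U := by
  obtain ⟨V, hV, h⟩ := FiberBundle.exists_contMDiffOn_extend (k := ∞) I Z s
  obtain ⟨U, hUV, hU, hxU⟩ := mem_nhds_iff.1 hV
  refine ⟨U ∩ (trivializationAt Z W x).baseSet, hU.inter (trivializationAt Z W x).open_baseSet,
    ⟨hxU, FiberBundle.mem_baseSet_trivializationAt' x⟩, ?_⟩
  refine (h.mono (Set.inter_subset_left.trans hUV)).congr fun y hy => ?_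
  rw [localExt_eq_extend R Z s hy.2]

theorem mdifferentiableAt_localExt (R : Type*) [NontriviallyNormedField R]
    (Z : Type*) [NormedAddCommGroup Z] [NormedSpace ℝ Z] [NormedSpace R Z] {W : M → Type*}
    [TopologicalSpace (TotalSpace Z W)] [∀ x, AddCommGroup (W x)] [∀ x, Module ℝ (W x)]
    [∀ x, Module R (W x)] [∀ x, TopologicalSpace (W x)] [FiberBundle Z W] [VectorBundle ℝ Z W]
    [VectorBundle R Z W] [ContMDiffVectorBundle ∞ Z W I] {x : M} (s : W x) :
    MDifferentiableAt I (I.prod 𝓘(ℝ, Z)) (fun y ↦ TotalSpace.mk' Z y (localExt R Z s y)) x := by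
  obtain ⟨U, hU, hx, h⟩ := exists_contMDiffOn_localExt (I := I) R Z s
  exact (h.contMDiffAt (hU.mem_nhds hx)).mdifferentiableAt (by simp)

variable [IsManifold I ∞ M] {g : PseudoRiemannianMetric I M} {F S 𝕜}
  [IsScalarTower ℝ 𝕜 F] [ContMDiffVectorBundle ∞ F S I]

theorem SpinorConnection.contMDiffOn_apply (D : SpinorConnection 𝕜 I F S) {U : Set M}
    (hU : IsOpen U) {σ : Π y : M, S y} {Y : Π y : M, TangentSpace I y}
    (hσ : ContMDiffOn I (I.prod 𝓘(ℝ, F)) ∞ (fun y ↦ TotalSpace.mk' F y (σ y)) U)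
    (hY : ContMDiffOn I (I.prod 𝓘(ℝ, E)) ∞ (fun y ↦ TotalSpace.mk' E y (Y y)) U) :
    ContMDiffOn I (I.prod 𝓘(ℝ, F)) ∞
      (fun y ↦ TotalSpace.mk' F y (D.toFun σ y (Y y))) U :=
  ((D.contMDiffOn U hU).contMDiff (σ := σ) hσ).clm_bundle_apply hY

theorem exists_nhds_smooth {x : M} (s t : S x) (v : TangentSpace I x) :
    ∃ U : Set M, IsOpen U ∧ x ∈ U ∧
      ContMDiffOn I (I.prod 𝓘(ℝ, F)) ∞ (fun y ↦ TotalSpace.mk' F y (localExt 𝕜 F s y)) U ∧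
      ContMDiffOn I (I.prod 𝓘(ℝ, F)) ∞ (fun y ↦ TotalSpace.mk' F y (localExt 𝕜 F t y)) U ∧
      ContMDiffOn I (I.prod 𝓘(ℝ, E)) ∞ (fun y ↦ TotalSpace.mk' E y (localExt ℝ E v y)) U := by
  obtain ⟨U₁, hU₁, hx₁, h₁⟩ := exists_contMDiffOn_localExt (I := I) 𝕜 F s
  obtain ⟨U₂, hU₂, hx₂, h₂⟩ := exists_contMDiffOn_localExt (I := I) 𝕜 F t
  obtain ⟨U₃, hU₃, hx₃, h₃⟩ := exists_contMDiffOn_localExt (I := I) ℝ E v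
  exact ⟨U₁ ∩ U₂ ∩ U₃, (hU₁.inter hU₂).inter hU₃, ⟨⟨hx₁, hx₂⟩, hx₃⟩,
    h₁.mono fun y hy => hy.1.1, h₂.mono fun y hy => hy.1.2, h₃.mono fun y hy => hy.2⟩

theorem secondDeriv_add (D : SpinorConnection 𝕜 I F S) {x : M} (u v : TangentSpace I x)
    (s t : S x) :
    D.toFun (fun y => D.toFun (localExt 𝕜 F (s + t)) y (localExt ℝ E v y)) x u
      = D.toFun (fun y => D.toFun (localExt 𝕜 F s) y (localExt ℝ E v y)) x u
        + D.toFun (fun y => D.toFun (localExt 𝕜 F t) y (localExt ℝ E v y)) x u := by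
  obtain ⟨U, hU, hxU, k₁, k₂, k₃⟩ := exists_nhds_smooth (𝕜 := 𝕜) (F := F) s t v
  have hx : U ∈ 𝓝 x := hU.mem_nhds hxU
  have m₁ := ((D.contMDiffOn_apply hU k₁ k₃).contMDiffAt hx).mdifferentiableAt (by simp)
  have m₂ := ((D.contMDiffOn_apply hU k₂ k₃).contMDiffAt hx).mdifferentiableAt (by simp)
  have hD := D.isCovariantDerivativeOnUniv
  have heq : ∀ y ∈ U, D.toFun (localExt 𝕜 F (s + t)) y (localExt ℝ E v y)
      = D.toFun (localExt 𝕜 F s) y (localExt ℝ E v y)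
        + D.toFun (localExt 𝕜 F t) y (localExt ℝ E v y) := by
    intro y hy
    rw [localExt_add, hD.add ((k₁.contMDiffAt (hU.mem_nhds hy)).mdifferentiableAt (by simp))
      ((k₂.contMDiffAt (hU.mem_nhds hy)).mdifferentiableAt (by simp))]
    rfl
  have hm := mdifferentiableAt_add_section m₁ m₂
  have key := hD.congr_of_eventuallyEq
    (σ := fun y => D.toFun (localExt 𝕜 F (s + t)) y (localExt ℝ E v y))
    (σ' := (fun y => D.toFun (localExt 𝕜 F s) y (localExt ℝ E v y))
      + (fun y => D.toFun (localExt 𝕜 F t) y (localExt ℝ E v y))) (x := x)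
    (hm.congr_of_eventuallyEq ?_) hm Filter.univ_mem ?_
  · rw [key, hD.add m₁ m₂]
    rfl
  · filter_upwards [hx] with y hy
    rw [heq y hy]
    rfl
  · filter_upwards [hx] with y hy
    exact heq y hy

theorem mdifferentiableAt_smul_section (c : 𝕜) {x : M} {σ : Π y : M, S y}
    (h : MDifferentiableAt I (I.prod 𝓘(ℝ, F)) (fun y ↦ TotalSpace.mk' F y (σ y)) x) :
    MDifferentiableAt I (I.prod 𝓘(ℝ, F)) (fun y ↦ TotalSpace.mk' F y ((c • σ) y)) x := by
  rw [mdifferentiableAt_section] at h ⊢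
  have h' : MDifferentiableAt I 𝓘(ℝ, F)
      (fun y => c • (trivializationAt F S x (TotalSpace.mk' F y (σ y))).2) x := by
    have hc : Differentiable ℝ (fun w : F => c • w) := differentiable_id.const_smul c
    exact (hc _).mdifferentiableAt.comp x h
  refine h'.congr_of_eventuallyEq ?_
  filter_upwards [(trivializationAt F S x).open_baseSet.mem_nhds
    (FiberBundle.mem_baseSet_trivializationAt' x)] with y hy
  exact (Trivialization.linear 𝕜 (trivializationAt F S x) hy).map_smul c (σ y)

theorem secondDeriv_smul (D : SpinorConnection 𝕜 I F S) {x : M} (u v : TangentSpace I x)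
    (c : 𝕜) (s : S x) :
    D.toFun (fun y => D.toFun (localExt 𝕜 F (c • s)) y (localExt ℝ E v y)) x u
      = c • D.toFun (fun y => D.toFun (localExt 𝕜 F s) y (localExt ℝ E v y)) x u := by
  obtain ⟨U, hU, hxU, k₁, k₂, k₃⟩ := exists_nhds_smooth (𝕜 := 𝕜) (F := F) s s v
  have hx : U ∈ 𝓝 x := hU.mem_nhds hxU
  have m₁ := ((D.contMDiffOn_apply hU k₁ k₃).contMDiffAt hx).mdifferentiableAt (by simp)
  have hD := D.isCovariantDerivativeOnUniv
  have heq : ∀ y ∈ U, D.toFun (localExt 𝕜 F (c • s)) y (localExt ℝ E v y)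
      = c • D.toFun (localExt 𝕜 F s) y (localExt ℝ E v y) := by
    intro y hy
    rw [localExt_smul,
      D.map_smul _ _ _ ((k₁.contMDiffAt (hU.mem_nhds hy)).mdifferentiableAt (by simp))]
  have hm := mdifferentiableAt_smul_section c m₁
  have key := hD.congr_of_eventuallyEq
    (σ := fun y => D.toFun (localExt 𝕜 F (c • s)) y (localExt ℝ E v y))
    (σ' := c • (fun y => D.toFun (localExt 𝕜 F s) y (localExt ℝ E v y))) (x := x)
    (hm.congr_of_eventuallyEq ?_) hm Filter.univ_mem ?_
  · rw [key, D.map_smul _ _ _ m₁]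
  · filter_upwards [hx] with y hy
    rw [heq y hy]
    rfl
  · filter_upwards [hx] with y hy
    exact heq y hy

/-- The curvature `R(u, v) ∈ End(S_x)`,
`R(X, Y)σ = D_X D_Y σ - D_Y D_X σ - D_[X,Y] σ`, where `X, Y, σ` extend `u, v, s`. -/
def curvature (D : SpinorConnection 𝕜 I F S) (x : M) (u v : TangentSpace I x) :
    S x →ₗ[𝕜] S x where
  toFun s :=
    D.toFun (fun y => D.toFun (localExt 𝕜 F s) y (localExt ℝ E v y)) x u
      - D.toFun (fun y => D.toFun (localExt 𝕜 F s) y (localExt ℝ E u y)) x v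
      - D.toFun (localExt 𝕜 F s) x
          (VectorField.mlieBracket I (localExt ℝ E u) (localExt ℝ E v) x)
  map_add' s t := by
    rw [secondDeriv_add, secondDeriv_add, localExt_add,
      D.isCovariantDerivativeOnUniv.add (mdifferentiableAt_localExt 𝕜 F s)
        (mdifferentiableAt_localExt 𝕜 F t), add_apply]
    abel
  map_smul' c s := by
    rw [secondDeriv_smul, secondDeriv_smul, localExt_smul,
      D.map_smul _ _ _ (mdifferentiableAt_localExt 𝕜 F s), RingHom.id_apply, smul_sub, smul_sub]

/-- The connection form of `D` at `x` in the direction `v`: the endomorphism `s ↦ D_v σ`, where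
`σ` is the constant coefficient extension of `s`. -/
def connectionForm (D : SpinorConnection 𝕜 I F S) (x : M) (v : TangentSpace I x) :
    S x →ₗ[𝕜] S x where
  toFun s := D.toFun (localExt 𝕜 F s) x v
  map_add' s t := by
    rw [localExt_add, D.isCovariantDerivativeOnUniv.add (mdifferentiableAt_localExt 𝕜 F s)
        (mdifferentiableAt_localExt 𝕜 F t), add_apply]
  map_smul' c s := by
    rw [localExt_smul, D.map_smul _ _ _ (mdifferentiableAt_localExt 𝕜 F s), RingHom.id_apply]

theorem mdifferentiableAt_clifford (γ : CliffordMultiplication 𝕜 F S g) {x : M}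
    (v : TangentSpace I x) (s : S x) :
    MDifferentiableAt I (I.prod 𝓘(ℝ, F)) (fun y ↦ TotalSpace.mk' F y
      (γ.val y (localExt ℝ E v y) (localExt 𝕜 F s y))) x :=
  MDifferentiableAt.clm_bundle_apply₂ (F₁ := E) (F₂ := F)
    ((γ.contMDiff x).mdifferentiableAt (by simp)) (mdifferentiableAt_localExt ℝ E v)
    (mdifferentiableAt_localExt 𝕜 F s)

/-- The endomorphism `(D̂_u γ)(v)` of `S_x`,
`(D̂_Z γ)(X) ξ = D_Z (γ(X) ξ) - γ(∇_Z X) ξ - γ(X) D^C_Z ξ`, where `X, ξ` extend `v, s`. -/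
def hatDgamma (γ : CliffordMultiplication 𝕜 F S g)
    (nabla : CovariantDerivative I E (TangentSpace I : M → Type _))
    (D DC : SpinorConnection 𝕜 I F S) (x : M) (u v : TangentSpace I x) : S x →ₗ[𝕜] S x where
  toFun s :=
    D.toFun (fun y => γ.val y (localExt ℝ E v y) (localExt 𝕜 F s y)) x u
      - γ.val x (nabla (localExt ℝ E v) x u) s
      - γ.val x v (DC.toFun (localExt 𝕜 F s) x u)
  map_add' s t := by
    have h : (fun y => γ.val y (localExt ℝ E v y) (localExt 𝕜 F (s + t) y))
      = (fun y => γ.val y (localExt ℝ E v y) (localExt 𝕜 F s y))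
        + (fun y => γ.val y (localExt ℝ E v y) (localExt 𝕜 F t y)) := by
      funext y
      simp [localExt_add]
    rw [h, D.isCovariantDerivativeOnUniv.add (mdifferentiableAt_clifford γ v s)
      (mdifferentiableAt_clifford γ v t), localExt_add,
      DC.isCovariantDerivativeOnUniv.add (mdifferentiableAt_localExt 𝕜 F s)
        (mdifferentiableAt_localExt 𝕜 F t)]
    simp only [add_apply, map_add]
    abel
  map_smul' c s := by
    have h : (fun y => γ.val y (localExt ℝ E v y) (localExt 𝕜 F (c • s) y))
      = c • (fun y => γ.val y (localExt ℝ E v y) (localExt 𝕜 F s y)) := by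
      funext y
      simp [localExt_smul, γ.map_smul]
    rw [h, D.map_smul _ _ _ (mdifferentiableAt_clifford γ v s), localExt_smul,
      DC.map_smul _ _ _ (mdifferentiableAt_localExt 𝕜 F s), γ.map_smul, γ.map_smul,
      RingHom.id_apply, smul_sub, smul_sub]

/-- The torsion `𝒯(u, v) ∈ End(S_x)` of `D`: two times the skew symmetrization of `D̂γ`. -/
def torsion (γ : CliffordMultiplication 𝕜 F S g)
    (nabla : CovariantDerivative I E (TangentSpace I : M → Type _))
    (D DC : SpinorConnection 𝕜 I F S) (x : M) (u v : TangentSpace I x) : S x →ₗ[𝕜] S x :=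
  hatDgamma γ nabla D DC x u v - hatDgamma γ nabla D DC x v u

/-- `(𝒦, D)` is admissible: the symmetric part of `D̂γ` acts trivially on `𝒦`. -/
def IsAdmissible (γ : CliffordMultiplication 𝕜 F S g)
    (nabla : CovariantDerivative I E (TangentSpace I : M → Type _))
    (D DC : SpinorConnection 𝕜 I F S) (K : Set (ContMDiffSection I F ∞ S)) : Prop :=
  ∀ φ ∈ K, ∀ (x : M) (u v : TangentSpace I x),
    (hatDgamma γ nabla D DC x u v + hatDgamma γ nabla D DC x v u) (φ x) = 0

end Tensors

/-! ### The graded manifold `(M, ΓΛS)` -/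

section GradedManifold

variable {F S 𝕜} [FiniteDimensional 𝕜 F]

/-- The coefficient functions `f_A` in `f = ∑_A f_A θ_A` of a section `f` of `ΛS`, with respect to
the local frame `θ_A = θ_{k_1} ∧ ⋯ ∧ θ_{k_p}`, `A = {k_1 < ⋯ < k_p}`, where `θ_k` is the local frame
of `S` given by the preferred trivialization at `x₀` and a basis of the model fibre `F`. -/
def coeff (x₀ : M) (f : Π x, ExteriorAlgebra 𝕜 (S x)) (A : Finset (Fin (finrank 𝕜 F))) (x : M) :
    𝕜 :=
  (finBasis 𝕜 F).ExteriorAlgebra.repr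
    (ExteriorAlgebra.map ((trivializationAt F S x₀).linearMapAt 𝕜 x) (f x)) A

/-- The element `θ_A(x₀)` of the frame of `ΛS` at `x₀` that belongs to `coeff`. -/
def frameAt (x₀ : M) (A : Finset (Fin (finrank 𝕜 F))) : ExteriorAlgebra 𝕜 (S x₀) :=
  ExteriorAlgebra.map ((trivializationAt F S x₀).symmₗ 𝕜 x₀) ((finBasis 𝕜 F).ExteriorAlgebra A)

variable (I F) in
/-- The functions on the graded manifold: smooth sections of `ΛS`. -/
def IsSuperfunction (f : Π x, ExteriorAlgebra 𝕜 (S x)) : Prop :=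
  ∀ (x₀ : M) (A : Finset (Fin (finrank 𝕜 F))),
    ContMDiffAt I 𝓘(ℝ, 𝕜) ∞ (coeff (F := F) x₀ f A) x₀

/-- Superfunctions of parity `p`. -/
def IsHomogeneous (p : ZMod 2) (f : Π x, ExteriorAlgebra 𝕜 (S x)) : Prop :=
  ∀ x, f x ∈ CliffordAlgebra.evenOdd (0 : QuadraticForm 𝕜 (S x)) p

variable (I F) in
/-- `Z` is a vector field of parity `p` on the graded manifold: a graded derivation
of parity `p` of the algebra of superfunctions. -/
structure IsSuperVectorField (p : ZMod 2)
    (Z : (Π x, ExteriorAlgebra 𝕜 (S x)) → (Π x, ExteriorAlgebra 𝕜 (S x))) : Prop where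
  smooth : ∀ f, IsSuperfunction I F f → IsSuperfunction I F (Z f)
  map_add : ∀ f h, IsSuperfunction I F f → IsSuperfunction I F h → Z (f + h) = Z f + Z h
  map_smul : ∀ (c : 𝕜) f, IsSuperfunction I F f → Z (c • f) = c • Z f
  parity : ∀ (q : ZMod 2) f, IsSuperfunction I F f → IsHomogeneous q f →
    IsHomogeneous (p + q) (Z f)
  leibniz : ∀ (q : ZMod 2) f h, IsSuperfunction I F f → IsHomogeneous q f →
    IsSuperfunction I F h → Z (f * h) = Z f * h + (-1 : 𝕜) ^ (p.val * q.val) • (f * Z h)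

/-- The supercommutator `[Z, W] = Z W - (-1)^{pq} W Z` of vector fields of parities `p, q`. -/
def superBracket (p q : ZMod 2)
    (Z W : (Π x, ExteriorAlgebra 𝕜 (S x)) → (Π x, ExteriorAlgebra 𝕜 (S x)))
    (f : Π x, ExteriorAlgebra 𝕜 (S x)) : Π x, ExteriorAlgebra 𝕜 (S x) :=
  Z (W f) - (-1 : 𝕜) ^ (p.val * q.val) • W (Z f)

variable [IsScalarTower ℝ 𝕜 F] [ContMDiffVectorBundle ∞ F S I] [IsManifold I ∞ M]

/-- The action of `ȷ_D(v)`, `v ∈ T_x M`, on superfunctions, i.e. the covariant derivative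
`D_v f ∈ ΛS_x` for the extension of `D` to `ΛS` as a derivation of degree zero:
`D_v (∑_A f_A θ_A) = ∑_A (v f_A) θ_A + ∑_A f_A D_v θ_A`. -/
def superD (D : SpinorConnection 𝕜 I F S) (f : Π x, ExteriorAlgebra 𝕜 (S x)) (x : M)
    (v : TangentSpace I x) : ExteriorAlgebra 𝕜 (S x) :=
  ∑ A : Finset (Fin (finrank 𝕜 F)),
      (mvfderiv I (coeff (F := F) x f A) x v : 𝕜) • frameAt (F := F) x A
    + derivOfEnd (connectionForm D x v) (f x)

variable {g : PseudoRiemannianMetric I M} {ι : Type*} [Fintype ι] [DecidableEq ι]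

/-- The vector field `ı(φ) = γ^μ φ ⊗ ȷ_D(e_μ)` on the graded manifold. Here `e` is a choice of a
basis of each tangent space; as a contraction with the metric, the sum does not depend on it. -/
def iota (γ : CliffordMultiplication 𝕜 F S g) (D : SpinorConnection 𝕜 I F S)
    (e : ∀ x : M, Basis ι ℝ (TangentSpace I x)) (φ : Π x, S x)
    (f : Π x, ExteriorAlgebra 𝕜 (S x)) (x : M) : ExteriorAlgebra 𝕜 (S x) :=
  ∑ μ, ExteriorAlgebra.ι 𝕜 (γ.val x (g.raise (e x) μ) (φ x)) * superD D f x (e x μ)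

/-- The curvature term `𝔅(R; φ, ψ) = γ^μ φ ∧ γ^ν ψ ⊗ R_{μν}`, for a `2`-form `R` with values in
the endomorphisms of `S`; `R_{μν}` acts on superfunctions as a derivation of degree zero. -/
def curvatureTerm (γ : CliffordMultiplication 𝕜 F S g)
    (R : ∀ x : M, TangentSpace I x → TangentSpace I x → S x →ₗ[𝕜] S x)
    (e : ∀ x : M, Basis ι ℝ (TangentSpace I x)) (φ ψ : Π x, S x)
    (f : Π x, ExteriorAlgebra 𝕜 (S x)) (x : M) : ExteriorAlgebra 𝕜 (S x) :=
  ∑ μ, ∑ ν, ExteriorAlgebra.ι 𝕜 (γ.val x (g.raise (e x) μ) (φ x))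
    * ExteriorAlgebra.ι 𝕜 (γ.val x (g.raise (e x) ν) (ψ x))
    * derivOfEnd (R x (e x μ) (e x ν)) (f x)

/-- The torsion term
`𝔇(𝒯; φ, ψ) = (γ^μ φ ∧ 𝒯_{μν} ψ + γ^μ ψ ∧ 𝒯_{μν} φ) ⊗ D^ν`, for a `2`-form `T` with values in the
endomorphisms of `S`. -/
def torsionTerm (γ : CliffordMultiplication 𝕜 F S g) (D : SpinorConnection 𝕜 I F S)
    (T : ∀ x : M, TangentSpace I x → TangentSpace I x → S x →ₗ[𝕜] S x)
    (e : ∀ x : M, Basis ι ℝ (TangentSpace I x)) (φ ψ : Π x, S x)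
    (f : Π x, ExteriorAlgebra 𝕜 (S x)) (x : M) : ExteriorAlgebra 𝕜 (S x) :=
  ∑ μ, ∑ ν,
    (ExteriorAlgebra.ι 𝕜 (γ.val x (g.raise (e x) μ) (φ x))
        * ExteriorAlgebra.ι 𝕜 (T x (e x μ) (e x ν) (ψ x))
      + ExteriorAlgebra.ι 𝕜 (γ.val x (g.raise (e x) μ) (ψ x))
        * ExteriorAlgebra.ι 𝕜 (T x (e x μ) (e x ν) (φ x)))
    * superD D f x (g.raise (e x) ν)

end GradedManifold

end SpinorSuper

end

open SpinorSuper

noncomputable section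

namespace SpinorSuper

section Algebra

variable {R : Type*} [CommRing R] {V W : Type*} [AddCommGroup V] [Module R V]
  [AddCommGroup W] [Module R W]

theorem derivOfEnd_algebraMap (Φ : V →ₗ[R] V) (r : R) :
    derivOfEnd Φ (algebraMap R (ExteriorAlgebra R V) r) = 0 := by
  simp [derivOfEnd, TrivSqZeroExt.algebraMap_eq_inl']

theorem derivOfEnd_add_end (Φ Ψ : V →ₗ[R] V) (a : ExteriorAlgebra R V) :
    derivOfEnd (Φ + Ψ) a = derivOfEnd Φ a + derivOfEnd Ψ a := by
  induction a using ExteriorAlgebra.induction with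
  | algebraMap r => simp [derivOfEnd_algebraMap]
  | ι v => simp [derivOfEnd_ι]
  | mul a b ha hb => rw [derivOfEnd_mul, derivOfEnd_mul, derivOfEnd_mul, ha, hb]; noncomm_ring
  | add a b ha hb => rw [map_add, map_add, map_add, ha, hb]; abel

theorem derivOfEnd_smul_end (c : R) (Φ : V →ₗ[R] V) (a : ExteriorAlgebra R V) :
    derivOfEnd (c • Φ) a = c • derivOfEnd Φ a := by
  induction a using ExteriorAlgebra.induction with
  | algebraMap r => simp [derivOfEnd_algebraMap]
  | ι v => simp [derivOfEnd_ι]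
  | mul a b ha hb => rw [derivOfEnd_mul, derivOfEnd_mul, ha, hb]; simp
  | add a b ha hb => rw [map_add, map_add, ha, hb, smul_add]

/-- Parity is determined by the values on generators: a linear map `T` that respects products
with two generators and maps scalars and generators to the correct parity preserves parity. -/
theorem map_mem_evenOdd_of_generators
    (T : ExteriorAlgebra R V →ₗ[R] ExteriorAlgebra R W)
    (h₀ : ∀ r, T (algebraMap R _ r) ∈ CliffordAlgebra.evenOdd (0 : QuadraticForm R W) 0)
    (h₁ : ∀ v, T (ExteriorAlgebra.ι R v) ∈ CliffordAlgebra.evenOdd (0 : QuadraticForm R W) 1)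
    (h₂ : ∀ (p : ZMod 2) (v w : V) (a : ExteriorAlgebra R V),
      a ∈ CliffordAlgebra.evenOdd (0 : QuadraticForm R V) p →
      T a ∈ CliffordAlgebra.evenOdd (0 : QuadraticForm R W) p →
      T (ExteriorAlgebra.ι R v * ExteriorAlgebra.ι R w * a)
        ∈ CliffordAlgebra.evenOdd (0 : QuadraticForm R W) p)
    {p : ZMod 2} {a : ExteriorAlgebra R V}
    (ha : a ∈ CliffordAlgebra.evenOdd (0 : QuadraticForm R V) p) :
    T a ∈ CliffordAlgebra.evenOdd (0 : QuadraticForm R W) p := by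
  induction a, ha using CliffordAlgebra.evenOdd_induction with
  | range_ι_pow v h =>
    have hp : p = 0 ∨ p = 1 := (by decide : ∀ p : ZMod 2, p = 0 ∨ p = 1) p
    rcases hp with rfl | rfl
    · rw [ZMod.val_zero, pow_zero] at h
      obtain ⟨r, rfl⟩ := Submodule.mem_one.1 h
      exact h₀ r
    · rw [ZMod.val_one, pow_one] at h
      obtain ⟨r, rfl⟩ := h
      exact h₁ r
  | add x y hx hy ihx ihy =>
    rw [map_add]
    exact Submodule.add_mem _ ihx ihy
  | ι_mul_ι_mul v w x hx ih => exact h₂ p v w x hx ih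

theorem ι_mem_evenOdd (v : V) :
    ExteriorAlgebra.ι R v ∈ CliffordAlgebra.evenOdd (0 : QuadraticForm R V) 1 :=
  CliffordAlgebra.ι_mem_evenOdd_one _ v

theorem mul_mem_evenOdd {p q : ZMod 2} {a b : ExteriorAlgebra R V}
    (ha : a ∈ CliffordAlgebra.evenOdd (0 : QuadraticForm R V) p)
    (hb : b ∈ CliffordAlgebra.evenOdd (0 : QuadraticForm R V) q) :
    a * b ∈ CliffordAlgebra.evenOdd (0 : QuadraticForm R V) (p + q) :=
  SetLike.mul_mem_graded ha hb

theorem ι_mul_ι_mul_mem_evenOdd {p : ZMod 2} (v w : V) {a : ExteriorAlgebra R V}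
    (ha : a ∈ CliffordAlgebra.evenOdd (0 : QuadraticForm R V) p) :
    ExteriorAlgebra.ι R v * ExteriorAlgebra.ι R w * a
      ∈ CliffordAlgebra.evenOdd (0 : QuadraticForm R V) p := by
  have h := mul_mem_evenOdd (mul_mem_evenOdd (ι_mem_evenOdd (R := R) v) (ι_mem_evenOdd w)) ha
  rwa [(by decide : ∀ p : ZMod 2, 1 + 1 + p = p) p] at h

theorem derivOfEnd_mem_evenOdd (Φ : V →ₗ[R] V) {p : ZMod 2} {a : ExteriorAlgebra R V}
    (ha : a ∈ CliffordAlgebra.evenOdd (0 : QuadraticForm R V) p) :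
    derivOfEnd Φ a ∈ CliffordAlgebra.evenOdd (0 : QuadraticForm R V) p := by
  refine map_mem_evenOdd_of_generators (derivOfEnd Φ) (fun r => ?_) (fun v => ?_)
    (fun p v w a ha ih => ?_) ha
  · rw [derivOfEnd_algebraMap]
    exact Submodule.zero_mem _
  · rw [derivOfEnd_ι]
    exact ι_mem_evenOdd _
  · rw [derivOfEnd_mul, derivOfEnd_mul, derivOfEnd_ι, derivOfEnd_ι, add_mul]
    exact Submodule.add_mem _ (Submodule.add_mem _ (ι_mul_ι_mul_mem_evenOdd _ _ ha)
      (ι_mul_ι_mul_mem_evenOdd _ _ ha)) (ι_mul_ι_mul_mem_evenOdd _ _ ih)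

theorem map_mem_evenOdd (T : V →ₗ[R] W) {p : ZMod 2} {a : ExteriorAlgebra R V}
    (ha : a ∈ CliffordAlgebra.evenOdd (0 : QuadraticForm R V) p) :
    ExteriorAlgebra.map T a ∈ CliffordAlgebra.evenOdd (0 : QuadraticForm R W) p := by
  refine map_mem_evenOdd_of_generators (ExteriorAlgebra.map T).toLinearMap (fun r => ?_)
    (fun v => ?_) (fun p v w a ha ih => ?_) ha
  · rw [AlgHom.toLinearMap_apply, AlgHom.commutes]
    exact SetLike.algebraMap_mem_graded _ r
  · rw [AlgHom.toLinearMap_apply, ExteriorAlgebra.map_apply_ι]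
    exact ι_mem_evenOdd _
  · simp only [AlgHom.toLinearMap_apply, map_mul, ExteriorAlgebra.map_apply_ι] at ih ⊢
    exact ι_mul_ι_mul_mem_evenOdd _ _ ih

theorem ι_anticomm (v w : V) :
    ExteriorAlgebra.ι R v * ExteriorAlgebra.ι R w
      = -(ExteriorAlgebra.ι R w * ExteriorAlgebra.ι R v) :=
  eq_neg_of_add_eq_zero_left (ExteriorAlgebra.ι_add_mul_swap v w)

/-- Elements of degree one supercommute with homogeneous elements. -/
theorem ι_mul_of_mem_evenOdd (v : V) {p : ZMod 2} {a : ExteriorAlgebra R V}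
    (ha : a ∈ CliffordAlgebra.evenOdd (0 : QuadraticForm R V) p) :
    ExteriorAlgebra.ι R v * a = (-1 : R) ^ p.val • (a * ExteriorAlgebra.ι R v) := by
  induction a, ha using CliffordAlgebra.evenOdd_induction with
  | range_ι_pow u h =>
    have hp : p = 0 ∨ p = 1 := (by decide : ∀ p : ZMod 2, p = 0 ∨ p = 1) p
    rcases hp with rfl | rfl
    · rw [ZMod.val_zero, pow_zero] at h ⊢
      obtain ⟨r, rfl⟩ := Submodule.mem_one.1 h
      rw [one_smul]
      exact (Algebra.commutes r _).symm
    · rw [ZMod.val_one, pow_one] at h ⊢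
      obtain ⟨r, rfl⟩ := h
      rw [neg_one_smul]
      exact ι_anticomm v r
  | add x y hx hy ihx ihy => rw [mul_add, ihx, ihy, add_mul, smul_add]
  | ι_mul_ι_mul u w x hx ih =>
    change ExteriorAlgebra.ι R v * (ExteriorAlgebra.ι R u * ExteriorAlgebra.ι R w * x)
      = _ • (ExteriorAlgebra.ι R u * ExteriorAlgebra.ι R w * x * ExteriorAlgebra.ι R v)
    have h : ExteriorAlgebra.ι R v * (ExteriorAlgebra.ι R u * ExteriorAlgebra.ι R w * x)
        = ExteriorAlgebra.ι R u * ExteriorAlgebra.ι R w * (ExteriorAlgebra.ι R v * x) := by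
      rw [← mul_assoc, ← mul_assoc, ← mul_assoc, ι_anticomm v u, neg_mul,
        mul_assoc (ExteriorAlgebra.ι R u), ι_anticomm v w]
      simp only [mul_neg, neg_neg, mul_assoc]
    rw [h, ih, mul_smul_comm, mul_assoc (ExteriorAlgebra.ι R u * ExteriorAlgebra.ι R w)]

end Algebra

/-! ### Smoothness and derivatives in coordinates -/

section Coordinates

variable {𝕜 : Type*} [RCLike 𝕜]
  {E : Type*} [NormedAddCommGroup E] [NormedSpace ℝ E]
  {H : Type*} [TopologicalSpace H] {I : ModelWithCorners ℝ E H}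
  {M : Type*} [TopologicalSpace M] [ChartedSpace H M]
  {V V₁ V₂ V₃ : Type*} [AddCommGroup V] [Module 𝕜 V] [AddCommGroup V₁] [Module 𝕜 V₁]
  [AddCommGroup V₂] [Module 𝕜 V₂] [AddCommGroup V₃] [Module 𝕜 V₃]
  {κ κ₁ κ₂ κ₃ : Type*} [Fintype κ] [Fintype κ₁] [Fintype κ₂] [Fintype κ₃]

theorem mvfderiv_congr {f h : M → 𝕜} {x : M} (hfh : f =ᶠ[𝓝 x] h) :
    mvfderiv I f x = mvfderiv I h x := by
  ext v
  simp only [mvfderiv, hfh.mfderiv_eq, ContinuousLinearMap.comp_apply]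
  rfl

theorem mdifferentiableAt_fun_sum {α : Type*} (s : Finset α) {a : α → M → 𝕜} {x : M}
    (ha : ∀ i ∈ s, MDifferentiableAt I 𝓘(ℝ, 𝕜) (a i) x) :
    MDifferentiableAt I 𝓘(ℝ, 𝕜) (fun y => ∑ i ∈ s, a i y) x := by
  classical
  induction s using Finset.induction_on with
  | empty => simpa using mdifferentiableAt_const
  | insert i s hi ih =>
    simp only [Finset.sum_insert hi]
    exact (ha i (Finset.mem_insert_self i s)).add
      (ih fun j hj => ha j (Finset.mem_insert_of_mem hj))

theorem mvfderiv_sum {α : Type*} (s : Finset α) {a : α → M → 𝕜} {x : M}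
    (ha : ∀ i ∈ s, MDifferentiableAt I 𝓘(ℝ, 𝕜) (a i) x) (v : TangentSpace I x) :
    mvfderiv I (fun y => ∑ i ∈ s, a i y) x v = ∑ i ∈ s, mvfderiv I (a i) x v := by
  classical
  induction s using Finset.induction_on with
  | empty =>
    simp only [Finset.sum_empty]
    rw [mvfderiv_const]
    rfl
  | insert i s hi ih =>
    have h₁ := ha i (Finset.mem_insert_self i s)
    have h₂ : ∀ j ∈ s, MDifferentiableAt I 𝓘(ℝ, 𝕜) (a j) x :=
      fun j hj => ha j (Finset.mem_insert_of_mem hj)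
    simp only [Finset.sum_insert hi]
    rw [mvfderiv_fun_add h₁ (mdifferentiableAt_fun_sum s h₂), ← ih h₂]
    rfl

theorem mdifferentiableAt_scalar_mul {a c : M → 𝕜} {x : M}
    (ha : MDifferentiableAt I 𝓘(ℝ, 𝕜) a x) (hc : MDifferentiableAt I 𝓘(ℝ, 𝕜) c x) :
    MDifferentiableAt I 𝓘(ℝ, 𝕜) (fun y => a y * c y) x :=
  (HasMFDerivAt.mul' ha.hasMFDerivAt hc.hasMFDerivAt).mdifferentiableAt

theorem mvfderiv_mul_apply {a c : M → 𝕜} {x : M} (ha : MDifferentiableAt I 𝓘(ℝ, 𝕜) a x)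
    (hc : MDifferentiableAt I 𝓘(ℝ, 𝕜) c x) (v : TangentSpace I x) :
    mvfderiv I (fun y => a y * c y) x v = mvfderiv I a x v * c x + a x * mvfderiv I c x v := by
  have h := ha.hasMFDerivAt.mul' hc.hasMFDerivAt
  have h' := congrArg (fun T => T v) h.mfderiv
  simp only [mvfderiv, ContinuousLinearMap.comp_apply]
  refine h'.trans ?_
  change a x * _ + _ * c x = _ * c x + a x * _
  exact add_comm _ _

theorem mvfderiv_mul_const_apply {a : M → 𝕜} {x : M} (ha : MDifferentiableAt I 𝓘(ℝ, 𝕜) a x)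
    (c : 𝕜) (v : TangentSpace I x) :
    mvfderiv I (fun y => a y * c) x v = mvfderiv I a x v * c := by
  rw [mvfderiv_mul_apply ha mdifferentiableAt_const, mvfderiv_const]
  simp

theorem contMDiffAt_scalar_mul {a c : M → 𝕜} {x : M} (ha : ContMDiffAt I 𝓘(ℝ, 𝕜) ∞ a x)
    (hc : ContMDiffAt I 𝓘(ℝ, 𝕜) ∞ c x) : ContMDiffAt I 𝓘(ℝ, 𝕜) ∞ (fun y => a y * c y) x := by
  have h : ContDiff ℝ ∞ fun p : 𝕜 × 𝕜 => p.1 * p.2 := contDiff_mul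
  exact h.contMDiff.contMDiffAt.comp x (ha.prodMk_space hc)

theorem contMDiffAt_scalar_sum {α : Type*} (s : Finset α) {a : α → M → 𝕜} {x : M}
    (ha : ∀ i ∈ s, ContMDiffAt I 𝓘(ℝ, 𝕜) ∞ (a i) x) :
    ContMDiffAt I 𝓘(ℝ, 𝕜) ∞ (fun y => ∑ i ∈ s, a i y) x := by
  classical
  induction s using Finset.induction_on with
  | empty => simpa using contMDiffAt_const
  | insert i s hi ih =>
    simp only [Finset.sum_insert hi]
    exact (ha i (Finset.mem_insert_self i s)).add
      (ih fun j hj => ha j (Finset.mem_insert_of_mem hj))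

variable (I) in
/-- The coordinates of `a : M → V` with respect to a basis of `V` are smooth at `x`. -/
def CoordSmoothAt (b : Basis κ 𝕜 V) (a : M → V) (x : M) : Prop :=
  ∀ i, ContMDiffAt I 𝓘(ℝ, 𝕜) ∞ (fun y => b.repr (a y) i) x

/-- The derivative of `a : M → V` in the direction `v`, computed in coordinates. -/
def coordDeriv (b : Basis κ 𝕜 V) (a : M → V) (x : M) (v : TangentSpace I x) : V :=
  ∑ i, mvfderiv I (fun y => b.repr (a y) i) x v • b i

theorem repr_coordDeriv (b : Basis κ 𝕜 V) (a : M → V) (x : M) (v : TangentSpace I x) (k : κ) :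
    b.repr (coordDeriv b a x v) k = mvfderiv I (fun y => b.repr (a y) k) x v := by
  classical
  simp [coordDeriv, Finsupp.single_apply]

theorem CoordSmoothAt.mdifferentiableAt {b : Basis κ 𝕜 V} {a : M → V} {x : M}
    (h : CoordSmoothAt I b a x) (i : κ) :
    MDifferentiableAt I 𝓘(ℝ, 𝕜) (fun y => b.repr (a y) i) x :=
  (h i).mdifferentiableAt (by simp)

theorem CoordSmoothAt.congr {b : Basis κ 𝕜 V} {a c : M → V} {x : M}
    (h : CoordSmoothAt I b a x) (hac : c =ᶠ[𝓝 x] a) : CoordSmoothAt I b c x := fun i =>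
  (h i).congr_of_eventuallyEq (hac.mono fun y hy => by simp only [hy])

theorem coordDeriv_congr (b : Basis κ 𝕜 V) {a c : M → V} {x : M} (hac : c =ᶠ[𝓝 x] a)
    (v : TangentSpace I x) : coordDeriv b c x v = coordDeriv b a x v := by
  refine Finset.sum_congr rfl fun i _ => ?_
  rw [mvfderiv_congr (h := fun y => b.repr (a y) i) (hac.mono fun y hy => by simp only [hy])]

theorem CoordSmoothAt.add {b : Basis κ 𝕜 V} {a c : M → V} {x : M} (ha : CoordSmoothAt I b a x)
    (hc : CoordSmoothAt I b c x) : CoordSmoothAt I b (fun y => a y + c y) x := fun i => by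
  simp only [map_add, Finsupp.add_apply]
  exact (ha i).add (hc i)

theorem repr_bilin (b₁ : Basis κ₁ 𝕜 V₁) (b₂ : Basis κ₂ 𝕜 V₂) (b₃ : Basis κ₃ 𝕜 V₃)
    (B : V₁ →ₗ[𝕜] V₂ →ₗ[𝕜] V₃) (u : V₁) (w : V₂) (k : κ₃) :
    b₃.repr (B u w) k
      = ∑ i, ∑ j, b₁.repr u i * b₂.repr w j * b₃.repr (B (b₁ i) (b₂ j)) k := by
  have h : B u w = ∑ i, ∑ j, (b₁.repr u i * b₂.repr w j) • B (b₁ i) (b₂ j) := by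
    conv_lhs => rw [← b₁.sum_repr u, ← b₂.sum_repr w]
    simp only [map_sum, map_smul, LinearMap.sum_apply, LinearMap.smul_apply, Finset.smul_sum,
      smul_smul]
    rw [Finset.sum_comm]
    simp only [mul_comm]
  rw [h]
  simp only [map_sum, map_smul, Finsupp.finsetSum_apply, Finsupp.smul_apply, smul_eq_mul]

theorem CoordSmoothAt.bilin {b₁ : Basis κ₁ 𝕜 V₁} {b₂ : Basis κ₂ 𝕜 V₂} (b₃ : Basis κ₃ 𝕜 V₃)
    (B : V₁ →ₗ[𝕜] V₂ →ₗ[𝕜] V₃) {a : M → V₁} {c : M → V₂} {x : M}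
    (ha : CoordSmoothAt I b₁ a x) (hc : CoordSmoothAt I b₂ c x) :
    CoordSmoothAt I b₃ (fun y => B (a y) (c y)) x := fun k => by
  rw [funext fun y => repr_bilin b₁ b₂ b₃ B (a y) (c y) k]
  exact contMDiffAt_scalar_sum _ fun i _ => contMDiffAt_scalar_sum _ fun j _ =>
    contMDiffAt_scalar_mul (contMDiffAt_scalar_mul (ha i) (hc j)) contMDiffAt_const

theorem coordDeriv_bilin {b₁ : Basis κ₁ 𝕜 V₁} {b₂ : Basis κ₂ 𝕜 V₂} (b₃ : Basis κ₃ 𝕜 V₃)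
    (B : V₁ →ₗ[𝕜] V₂ →ₗ[𝕜] V₃) {a : M → V₁} {c : M → V₂} {x : M}
    (ha : CoordSmoothAt I b₁ a x) (hc : CoordSmoothAt I b₂ c x) (v : TangentSpace I x) :
    coordDeriv b₃ (fun y => B (a y) (c y)) x v
      = B (coordDeriv b₁ a x v) (c x) + B (a x) (coordDeriv b₂ c x v) := by
  have hac : ∀ i j, MDifferentiableAt I 𝓘(ℝ, 𝕜)
      (fun y => b₁.repr (a y) i * b₂.repr (c y) j) x := fun i j =>
    mdifferentiableAt_scalar_mul (ha.mdifferentiableAt i) (hc.mdifferentiableAt j)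
  apply b₃.ext_elem
  intro k
  rw [repr_coordDeriv, map_add, Finsupp.add_apply]
  rw [funext fun y => repr_bilin b₁ b₂ b₃ B (a y) (c y) k, repr_bilin b₁ b₂ b₃ B,
    repr_bilin b₁ b₂ b₃ B]
  simp only [repr_coordDeriv]
  rw [mvfderiv_sum _ fun i _ => mdifferentiableAt_fun_sum _ fun j _ =>
    mdifferentiableAt_scalar_mul (hac i j) mdifferentiableAt_const, ← Finset.sum_add_distrib]
  refine Finset.sum_congr rfl fun i _ => ?_
  rw [mvfderiv_sum _ fun j _ => mdifferentiableAt_scalar_mul (hac i j) mdifferentiableAt_const,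
    ← Finset.sum_add_distrib]
  refine Finset.sum_congr rfl fun j _ => ?_
  rw [mvfderiv_mul_const_apply (hac i j),
    mvfderiv_mul_apply (ha.mdifferentiableAt i) (hc.mdifferentiableAt j)]
  ring

theorem repr_linear (b₁ : Basis κ₁ 𝕜 V₁) (b₂ : Basis κ₂ 𝕜 V₂) (T : V₁ →ₗ[𝕜] V₂) (u : V₁)
    (k : κ₂) : b₂.repr (T u) k = ∑ i, b₁.repr u i * b₂.repr (T (b₁ i)) k := by
  conv_lhs => rw [← b₁.sum_repr u]
  simp only [map_sum, map_smul, Finsupp.finsetSum_apply, Finsupp.smul_apply, smul_eq_mul]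

theorem CoordSmoothAt.linear {b₁ : Basis κ₁ 𝕜 V₁} (b₂ : Basis κ₂ 𝕜 V₂) (T : V₁ →ₗ[𝕜] V₂)
    {a : M → V₁} {x : M} (ha : CoordSmoothAt I b₁ a x) :
    CoordSmoothAt I b₂ (fun y => T (a y)) x := fun k => by
  rw [funext fun y => repr_linear b₁ b₂ T (a y) k]
  exact contMDiffAt_scalar_sum _ fun i _ => contMDiffAt_scalar_mul (ha i) contMDiffAt_const

theorem coordDeriv_linear {b₁ : Basis κ₁ 𝕜 V₁} (b₂ : Basis κ₂ 𝕜 V₂) (T : V₁ →ₗ[𝕜] V₂)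
    {a : M → V₁} {x : M} (ha : CoordSmoothAt I b₁ a x) (v : TangentSpace I x) :
    coordDeriv b₂ (fun y => T (a y)) x v = T (coordDeriv b₁ a x v) := by
  apply b₂.ext_elem
  intro k
  rw [repr_coordDeriv, funext fun y => repr_linear b₁ b₂ T (a y) k, repr_linear b₁ b₂ T]
  simp only [repr_coordDeriv]
  rw [mvfderiv_sum _ fun i _ => mdifferentiableAt_scalar_mul (ha.mdifferentiableAt i)
    mdifferentiableAt_const]
  exact Finset.sum_congr rfl fun i _ => mvfderiv_mul_const_apply (ha.mdifferentiableAt i) _ v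

theorem coordDeriv_add {b : Basis κ 𝕜 V} {a c : M → V} {x : M} (ha : CoordSmoothAt I b a x)
    (hc : CoordSmoothAt I b c x) (v : TangentSpace I x) :
    coordDeriv b (fun y => a y + c y) x v = coordDeriv b a x v + coordDeriv b c x v := by
  rw [coordDeriv, coordDeriv, coordDeriv, ← Finset.sum_add_distrib]
  refine Finset.sum_congr rfl fun i _ => ?_
  simp only [map_add, Finsupp.add_apply]
  rw [mvfderiv_fun_add (ha.mdifferentiableAt i) (hc.mdifferentiableAt i), ← add_smul]
  rfl

theorem coordDeriv_add_vec (b : Basis κ 𝕜 V) (a : M → V) (x : M) (u v : TangentSpace I x) :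
    coordDeriv b a x (u + v) = coordDeriv b a x u + coordDeriv b a x v := by
  simp [coordDeriv, add_smul, Finset.sum_add_distrib]

theorem coordDeriv_smul_vec (b : Basis κ 𝕜 V) (a : M → V) (x : M) (r : ℝ)
    (v : TangentSpace I x) : coordDeriv b a x (r • v) = (r : 𝕜) • coordDeriv b a x v := by
  simp [coordDeriv, Finset.smul_sum, smul_smul, RCLike.real_smul_eq_coe_mul]

/-- The derivative of a function with values in a linear subspace lies in this subspace. -/
theorem coordDeriv_mem (b : Basis κ 𝕜 V) (N : Submodule 𝕜 V) {a : M → V} {x : M}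
    (ha : CoordSmoothAt I b a x) (hN : ∀ᶠ y in 𝓝 x, a y ∈ N) (v : TangentSpace I x) :
    coordDeriv b a x v ∈ N := by
  by_contra h
  obtain ⟨l, hl, hlN⟩ := Submodule.exists_le_ker_of_notMem h
  apply hl
  have h₁ := coordDeriv_linear (Basis.singleton Unit 𝕜) l ha v
  rw [← h₁, coordDeriv_congr _ (c := fun y => l (a y)) (a := fun _ => 0)
    (hN.mono fun y hy => hlN hy)]
  simp [coordDeriv, mvfderiv_const]

end Coordinates

/-! ### Sections in coordinates and the Leibniz rule over `𝕜` -/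

section Sections

variable {𝕜 : Type*} [RCLike 𝕜]
  {E : Type*} [NormedAddCommGroup E] [NormedSpace ℝ E]
  {H : Type*} [TopologicalSpace H] {I : ModelWithCorners ℝ E H}
  {M : Type*} [TopologicalSpace M] [ChartedSpace H M]
  {F : Type*} [NormedAddCommGroup F] [NormedSpace ℝ F] [NormedSpace 𝕜 F]
  {S : M → Type*} [TopologicalSpace (TotalSpace F S)]
  [∀ x, AddCommGroup (S x)] [∀ x, Module ℝ (S x)] [∀ x, Module 𝕜 (S x)]
  [∀ x, TopologicalSpace (S x)]
  [FiberBundle F S] [VectorBundle ℝ F S] [VectorBundle 𝕜 F S]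
  [IsScalarTower ℝ 𝕜 F]

theorem ofReal_smul_fibre (𝕜 : Type*) [RCLike 𝕜] {M : Type*} [TopologicalSpace M]
    (F : Type*) [NormedAddCommGroup F] [NormedSpace ℝ F] [NormedSpace 𝕜 F] [IsScalarTower ℝ 𝕜 F]
    {S : M → Type*} [TopologicalSpace (TotalSpace F S)] [∀ x, AddCommGroup (S x)]
    [∀ x, Module ℝ (S x)] [∀ x, Module 𝕜 (S x)] [∀ x, TopologicalSpace (S x)]
    [FiberBundle F S] [VectorBundle ℝ F S] [VectorBundle 𝕜 F S]
    (x : M) (r : ℝ) (s : S x) : (r : 𝕜) • s = r • s := by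
  have hx := FiberBundle.mem_baseSet_trivializationAt F S x
  apply ((trivializationAt F S x).linearEquivAt 𝕜 x hx).injective
  have h₁ := (Trivialization.linear 𝕜 (trivializationAt F S x) hx).map_smul (r : 𝕜) s
  have h₂ := (Trivialization.linear ℝ (trivializationAt F S x) hx).map_smul r s
  rw [Trivialization.linearEquivAt_apply, Trivialization.linearEquivAt_apply]
  refine h₁.trans (Eq.trans ?_ h₂.symm)
  rw [RCLike.real_smul_eq_coe_smul (K := 𝕜)]

theorem coordSmoothAt_finBasis_iff [FiniteDimensional 𝕜 F] {a : M → F} {x : M} :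
    CoordSmoothAt I (finBasis 𝕜 F) a x ↔ ContMDiffAt I 𝓘(ℝ, F) ∞ a x := by
  let e : F ≃L[ℝ] (Fin (finrank 𝕜 F) → 𝕜) :=
    { (finBasis 𝕜 F).equivFun.restrictScalars ℝ with
      continuous_toFun := (finBasis 𝕜 F).equivFunL.continuous
      continuous_invFun := (finBasis 𝕜 F).equivFunL.symm.continuous }
  have h : CoordSmoothAt I (finBasis 𝕜 F) a x ↔
      ContMDiffAt I 𝓘(ℝ, Fin (finrank 𝕜 F) → 𝕜) ∞ (fun y => e (a y)) x := by
    rw [contMDiffAt_pi_space]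
    rfl
  rw [h]
  refine ⟨fun h => ?_, fun h => e.contDiff.contMDiff.contMDiffAt.comp x h⟩
  have h' := e.symm.contDiff.contMDiff.contMDiffAt.comp x h (n := ∞)
  exact h'.congr_of_eventuallyEq (Filter.Eventually.of_forall fun y => by simp)

theorem coordSmoothAt_section_iff [FiniteDimensional 𝕜 F] [ContMDiffVectorBundle ∞ F S I]
    {σ : Π x : M, S x} {x₀ y : M}
    (hy : y ∈ (trivializationAt F S x₀).baseSet) :
    CoordSmoothAt I (finBasis 𝕜 F) (fun z => (trivializationAt F S x₀).linearMapAt 𝕜 z (σ z)) y ↔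
      ContMDiffAt I (I.prod 𝓘(ℝ, F)) ∞ (fun z ↦ TotalSpace.mk' F z (σ z)) y := by
  rw [coordSmoothAt_finBasis_iff, Trivialization.contMDiffAt_section_iff _ hy]
  refine Filter.EventuallyEq.contMDiffAt_iff ?_
  filter_upwards [(trivializationAt F S x₀).open_baseSet.mem_nhds hy] with z hz
  rw [Trivialization.coe_linearMapAt_of_mem _ hz]

theorem mvfderiv_clm_comp {V W : Type*} [NormedAddCommGroup V] [NormedSpace ℝ V]
    [NormedAddCommGroup W] [NormedSpace ℝ W] (L : V →L[ℝ] W) {a : M → V} {x : M}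
    (ha : MDifferentiableAt I 𝓘(ℝ, V) a x) (v : TangentSpace I x) :
    mvfderiv I (fun y => L (a y)) x v = L (mvfderiv I a x v) := by
  have h := (L.hasMFDerivAt (x := a x)).comp x ha.hasMFDerivAt
  exact congrArg (fun T => T v) h.mfderiv

theorem mdifferentiableAt_clm_comp {V W : Type*} [NormedAddCommGroup V] [NormedSpace ℝ V]
    [NormedAddCommGroup W] [NormedSpace ℝ W] (L : V →L[ℝ] W) {a : M → V} {x : M}
    (ha : MDifferentiableAt I 𝓘(ℝ, V) a x) :
    MDifferentiableAt I 𝓘(ℝ, W) (fun y => L (a y)) x :=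
  ((L.hasMFDerivAt (x := a x)).comp x ha.hasMFDerivAt).mdifferentiableAt

theorem mdifferentiableAt_smul_fun_section {a : M → 𝕜} {σ : Π x : M, S x} {x : M}
    (ha : MDifferentiableAt I 𝓘(ℝ, 𝕜) a x)
    (hσ : MDifferentiableAt I (I.prod 𝓘(ℝ, F)) (fun y ↦ TotalSpace.mk' F y (σ y)) x) :
    MDifferentiableAt I (I.prod 𝓘(ℝ, F)) (fun y ↦ TotalSpace.mk' F y (a y • σ y)) x := by
  rw [mdifferentiableAt_section] at hσ ⊢
  have h := (ContinuousLinearMap.lsmul ℝ 𝕜 (E := F)).isBoundedBilinearMap.differentiableAt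
    _ |>.mdifferentiableAt.comp x (ha.prodMk_space hσ)
  refine h.congr_of_eventuallyEq ?_
  filter_upwards [(trivializationAt F S x).open_baseSet.mem_nhds
    (FiberBundle.mem_baseSet_trivializationAt' x)] with y hy
  exact (Trivialization.linear 𝕜 (trivializationAt F S x) hy).map_smul (a y) (σ y)

theorem localExt_symm (x y : M) (w : F) :
    localExt 𝕜 F ((trivializationAt F S x).symmₗ 𝕜 x w) y
      = (trivializationAt F S x).symmₗ 𝕜 y w := by
  rw [localExt, Trivialization.linearMapAt_symmₗ _ (FiberBundle.mem_baseSet_trivializationAt' x)]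

variable [∀ x, IsTopologicalAddGroup (S x)] [∀ x, ContinuousSMul ℝ (S x)]
  [IsManifold I ∞ M] [ContMDiffVectorBundle ∞ F S I]

/-- The Leibniz rule of a `𝕜`-linear connection for `𝕜`-valued functions. -/
theorem SpinorConnection.leibniz_smul (D : SpinorConnection 𝕜 I F S) {a : M → 𝕜}
    {σ : Π x : M, S x} {x : M} (ha : MDifferentiableAt I 𝓘(ℝ, 𝕜) a x)
    (hσ : MDifferentiableAt I (I.prod 𝓘(ℝ, F)) (fun y ↦ TotalSpace.mk' F y (σ y)) x)
    (v : TangentSpace I x) :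
    D.toFun (fun y => a y • σ y) x v = a x • D.toFun σ x v + mvfderiv I a x v • σ x := by
  let re : M → ℝ := fun y => RCLike.reCLM (a y)
  let im : M → ℝ := fun y => RCLike.imCLM (a y)
  have hre : MDifferentiableAt I 𝓘(ℝ, ℝ) re x := mdifferentiableAt_clm_comp RCLike.reCLM ha
  have him : MDifferentiableAt I 𝓘(ℝ, ℝ) im x := mdifferentiableAt_clm_comp RCLike.imCLM ha
  have hI := mdifferentiableAt_smul_section (RCLike.I : 𝕜) hσ
  have hdec : (fun y => a y • σ y) = re • σ + im • ((RCLike.I : 𝕜) • σ) := by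
    funext y
    change a y • σ y = RCLike.re (a y) • σ y + RCLike.im (a y) • ((RCLike.I : 𝕜) • σ y)
    rw [← ofReal_smul_fibre 𝕜 F y, ← ofReal_smul_fibre 𝕜 F y, smul_smul, ← add_smul,
      RCLike.re_add_im]
  have hD := D.isCovariantDerivativeOnUniv
  rw [hdec, hD.add (hre.smul_section hσ) (him.smul_section hI), hD.leibniz hσ hre,
    hD.leibniz hI him]
  simp only [add_apply, smul_apply,
    ContinuousLinearMap.smulRight_apply]
  rw [D.map_smul x _ σ hσ v, mvfderiv_clm_comp RCLike.reCLM ha,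
    mvfderiv_clm_comp RCLike.imCLM ha]
  change RCLike.re (a x) • D.toFun σ x v + RCLike.re (mvfderiv I a x v) • σ x
    + (RCLike.im (a x) • (RCLike.I : 𝕜) • D.toFun σ x v
      + RCLike.im (mvfderiv I a x v) • (RCLike.I : 𝕜) • σ x) = _
  simp only [← ofReal_smul_fibre 𝕜 F x, smul_smul]
  conv_rhs => rw [← RCLike.re_add_im (a x), ← RCLike.re_add_im (mvfderiv I a x v)]
  module

theorem SpinorConnection.apply_sum (D : SpinorConnection 𝕜 I F S) {α : Type*} (s : Finset α)
    {σ : α → Π x : M, S x} {x : M}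
    (hσ : ∀ i ∈ s, MDifferentiableAt I (I.prod 𝓘(ℝ, F)) (fun y ↦ TotalSpace.mk' F y (σ i y)) x)
    (v : TangentSpace I x) :
    D.toFun (fun y => ∑ i ∈ s, σ i y) x v = ∑ i ∈ s, D.toFun (σ i) x v := by
  classical
  have hD := D.isCovariantDerivativeOnUniv
  induction s using Finset.induction_on with
  | empty =>
    simp only [Finset.sum_empty]
    have h := hD.zero (x := x)
    exact congrArg (fun T => T v) h
  | insert i s hi ih =>
    have h₂ := fun j hj => hσ j (Finset.mem_insert_of_mem hj)
    simp only [Finset.sum_insert hi]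
    rw [← ih h₂]
    exact congrArg (fun T => T v) (hD.add (hσ i (Finset.mem_insert_self i s))
      (MDifferentiableAt.sum_section h₂))

theorem SpinorConnection.congr_nhds (D : SpinorConnection 𝕜 I F S) {σ τ : Π x : M, S x} {x : M}
    (hτ : MDifferentiableAt I (I.prod 𝓘(ℝ, F)) (fun y ↦ TotalSpace.mk' F y (τ y)) x)
    (h : ∀ᶠ y in 𝓝 x, σ y = τ y) : D.toFun σ x = D.toFun τ x :=
  D.isCovariantDerivativeOnUniv.congr_of_eventuallyEq
    (hτ.congr_of_eventuallyEq (h.mono fun y hy => by simp only [hy])) hτ Filter.univ_mem h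

variable [FiniteDimensional 𝕜 F]

/-- A connection in the preferred trivialization: derivative of the components plus connection
form. -/
theorem SpinorConnection.apply_eq (D : SpinorConnection 𝕜 I F S) {σ : Π x : M, S x} {x : M}
    (hσ : ContMDiffAt I (I.prod 𝓘(ℝ, F)) ∞ (fun y ↦ TotalSpace.mk' F y (σ y)) x)
    (v : TangentSpace I x) :
    D.toFun σ x v = (trivializationAt F S x).symmₗ 𝕜 x (coordDeriv (finBasis 𝕜 F)
        (fun y => (trivializationAt F S x).linearMapAt 𝕜 y (σ y)) x v)
      + connectionForm D x v (σ x) := by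
  have hx : x ∈ (trivializationAt F S x).baseSet := FiberBundle.mem_baseSet_trivializationAt' x
  have hc := (coordSmoothAt_section_iff (𝕜 := 𝕜) hx).2 hσ
  let c := fun k y => (finBasis 𝕜 F).repr ((trivializationAt F S x).linearMapAt 𝕜 y (σ y)) k
  let θ := fun k => localExt 𝕜 F ((trivializationAt F S x).symmₗ 𝕜 x (finBasis 𝕜 F k))
  have hθ : ∀ k, MDifferentiableAt I (I.prod 𝓘(ℝ, F)) (fun y ↦ TotalSpace.mk' F y (θ k y)) x :=
    fun k => mdifferentiableAt_localExt 𝕜 F _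
  have hcθ := fun k => mdifferentiableAt_smul_fun_section (hc.mdifferentiableAt k) (hθ k)
  have hdec : ∀ᶠ y in 𝓝 x, σ y = ∑ k, c k y • θ k y := by
    filter_upwards [(trivializationAt F S x).open_baseSet.mem_nhds hx] with y hy
    simp only [θ, localExt_symm, c, ← _root_.map_smul, ← map_sum]
    rw [(finBasis 𝕜 F).sum_repr, Trivialization.symmₗ_linearMapAt _ hy]
  rw [D.congr_nhds (MDifferentiableAt.sum_section fun k _ => hcθ k) hdec,
    D.apply_sum _ fun k _ => hcθ k]
  have h : σ x = ∑ k, c k x • θ k x := hdec.self_of_nhds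
  have h₁ : connectionForm D x v (σ x) = ∑ k, c k x • connectionForm D x v (θ k x) := by
    rw [h, map_sum]
    simp only [_root_.map_smul]
  rw [h₁, coordDeriv, map_sum, ← Finset.sum_add_distrib]
  refine Finset.sum_congr rfl fun k _ => ?_
  have hθx : θ k x = (trivializationAt F S x).symmₗ 𝕜 x (finBasis 𝕜 F k) := localExt_self 𝕜 F _
  rw [D.leibniz_smul (hc.mdifferentiableAt k) (hθ k), _root_.map_smul, hθx, add_comm]
  rfl

end Sections

/-! ### Smooth superfunctions at a point and their covariant derivatives -/

section Superfunctions

variable {𝕜 : Type*} [RCLike 𝕜]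
  {E : Type*} [NormedAddCommGroup E] [NormedSpace ℝ E]
  {H : Type*} [TopologicalSpace H] {I : ModelWithCorners ℝ E H}
  {M : Type*} [TopologicalSpace M] [ChartedSpace H M]
  {F : Type*} [NormedAddCommGroup F] [NormedSpace ℝ F] [NormedSpace 𝕜 F]
  {S : M → Type*} [TopologicalSpace (TotalSpace F S)]
  [∀ x, AddCommGroup (S x)] [∀ x, Module ℝ (S x)] [∀ x, Module 𝕜 (S x)]
  [∀ x, TopologicalSpace (S x)]
  [FiberBundle F S] [VectorBundle ℝ F S] [VectorBundle 𝕜 F S]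
  [IsScalarTower ℝ 𝕜 F] [FiniteDimensional 𝕜 F] [ContMDiffVectorBundle ∞ F S I]

variable (F) in
/-- A section of `ΛS` in the preferred trivialization at `x₀`. -/
def superCoord (x₀ : M) (f : Π x, ExteriorAlgebra 𝕜 (S x)) (y : M) : ExteriorAlgebra 𝕜 F :=
  ExteriorAlgebra.map ((trivializationAt F S x₀).linearMapAt 𝕜 y) (f y)

variable (I F) in
/-- Smoothness of a section of `ΛS` at a point. -/
def SmoothSuperAt (f : Π x, ExteriorAlgebra 𝕜 (S x)) (x : M) : Prop :=
  CoordSmoothAt I (finBasis 𝕜 F).ExteriorAlgebra (superCoord F x f) x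

theorem isSuperfunction_iff {f : Π x, ExteriorAlgebra 𝕜 (S x)} :
    IsSuperfunction I F f ↔ ∀ x, SmoothSuperAt I F f x := Iff.rfl

theorem map_symm_superCoord {x₀ y : M} (hy : y ∈ (trivializationAt F S x₀).baseSet)
    (f : Π x, ExteriorAlgebra 𝕜 (S x)) :
    ExteriorAlgebra.map ((trivializationAt F S x₀).symmₗ 𝕜 y) (superCoord F x₀ f y) = f y := by
  rw [superCoord, ← AlgHom.comp_apply, ExteriorAlgebra.map_comp_map]
  have h : (trivializationAt F S x₀).symmₗ 𝕜 y ∘ₗ (trivializationAt F S x₀).linearMapAt 𝕜 y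
      = LinearMap.id := by
    ext s
    exact Trivialization.symmₗ_linearMapAt _ hy s
  rw [h, ExteriorAlgebra.map_id]
  rfl

theorem superCoord_add (x₀ : M) (f h : Π x, ExteriorAlgebra 𝕜 (S x)) :
    superCoord F x₀ (f + h) = fun y => superCoord F x₀ f y + superCoord F x₀ h y :=
  funext fun _ => map_add _ _ _

theorem superCoord_mul (x₀ : M) (f h : Π x, ExteriorAlgebra 𝕜 (S x)) :
    superCoord F x₀ (f * h) = fun y => superCoord F x₀ f y * superCoord F x₀ h y :=
  funext fun _ => map_mul _ _ _

theorem superCoord_algebraMap (x₀ : M) (a : M → 𝕜) :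
    superCoord F x₀ (fun y => algebraMap 𝕜 (ExteriorAlgebra 𝕜 (S y)) (a y))
      = fun y => Algebra.linearMap 𝕜 (ExteriorAlgebra 𝕜 F) (a y) :=
  funext fun _ => AlgHom.commutes _ _

theorem superCoord_ι (x₀ : M) (σ : Π x, S x) :
    superCoord F x₀ (fun y => ExteriorAlgebra.ι 𝕜 (σ y))
      = fun y => ExteriorAlgebra.ι 𝕜 ((trivializationAt F S x₀).linearMapAt 𝕜 y (σ y)) :=
  funext fun _ => ExteriorAlgebra.map_apply_ι _ _

theorem coordSmoothAt_singleton {a : M → 𝕜} {x : M} (ha : ContMDiffAt I 𝓘(ℝ, 𝕜) ∞ a x) :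
    CoordSmoothAt I (Basis.singleton Unit 𝕜) a x := fun _ => by
  simpa using ha

theorem coordDeriv_singleton (a : M → 𝕜) (x : M) (v : TangentSpace I x) :
    coordDeriv (Basis.singleton Unit 𝕜) a x v = mvfderiv I a x v := by
  simp [coordDeriv]

theorem coordSmoothAt_superCoord_ι {σ : Π x : M, S x} {x₀ y : M}
    (hy : y ∈ (trivializationAt F S x₀).baseSet)
    (hσ : ContMDiffAt I (I.prod 𝓘(ℝ, F)) ∞ (fun z ↦ TotalSpace.mk' F z (σ z)) y) :
    CoordSmoothAt I (finBasis 𝕜 F).ExteriorAlgebra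
      (superCoord F x₀ (fun y => ExteriorAlgebra.ι 𝕜 (σ y))) y := by
  rw [superCoord_ι]
  exact ((coordSmoothAt_section_iff hy).2 hσ).linear _ (ExteriorAlgebra.ι 𝕜)

theorem coordSmoothAt_superCoord_algebraMap {a : M → 𝕜} (x₀ : M) {y : M}
    (ha : ContMDiffAt I 𝓘(ℝ, 𝕜) ∞ a y) :
    CoordSmoothAt I (finBasis 𝕜 F).ExteriorAlgebra
      (superCoord F x₀ (fun y => algebraMap 𝕜 (ExteriorAlgebra 𝕜 (S y)) (a y))) y := by
  rw [superCoord_algebraMap]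
  exact (coordSmoothAt_singleton ha).linear (finBasis 𝕜 F).ExteriorAlgebra
    (Algebra.linearMap 𝕜 (ExteriorAlgebra 𝕜 F))

theorem coordSmoothAt_superCoord_mul {f h : Π x, ExteriorAlgebra 𝕜 (S x)} {x₀ y : M}
    (hf : CoordSmoothAt I (finBasis 𝕜 F).ExteriorAlgebra (superCoord F x₀ f) y)
    (hh : CoordSmoothAt I (finBasis 𝕜 F).ExteriorAlgebra (superCoord F x₀ h) y) :
    CoordSmoothAt I (finBasis 𝕜 F).ExteriorAlgebra (superCoord F x₀ (f * h)) y := by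
  rw [superCoord_mul]
  exact hf.bilin (finBasis 𝕜 F).ExteriorAlgebra (LinearMap.mul 𝕜 (ExteriorAlgebra 𝕜 F)) hh

theorem contMDiffAt_symm_section (x₀ : M) {y : M} (hy : y ∈ (trivializationAt F S x₀).baseSet)
    (w : F) : ContMDiffAt I (I.prod 𝓘(ℝ, F)) ∞
      (fun z ↦ TotalSpace.mk' F z ((trivializationAt F S x₀).symmₗ 𝕜 z w)) y := by
  rw [Trivialization.contMDiffAt_section_iff _ hy]
  refine (contMDiffAt_const (c := w)).congr_of_eventuallyEq ?_
  filter_upwards [(trivializationAt F S x₀).open_baseSet.mem_nhds hy] with z hz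
  have h := Trivialization.linearMapAt_symmₗ (R := 𝕜) (trivializationAt F S x₀) hz w
  rwa [Trivialization.coe_linearMapAt_of_mem _ hz] at h

/-- Sections of `ΛS` with constant coefficients in one trivialization are smooth in another. -/
theorem coordSmoothAt_superCoord_map_symm {x₀ x₁ y : M}
    (h₀ : y ∈ (trivializationAt F S x₀).baseSet) (h₁ : y ∈ (trivializationAt F S x₁).baseSet)
    (a : ExteriorAlgebra 𝕜 F) :
    CoordSmoothAt I (finBasis 𝕜 F).ExteriorAlgebra
      (superCoord F x₀ (fun z => ExteriorAlgebra.map ((trivializationAt F S x₁).symmₗ 𝕜 z) a))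
      y := by
  induction a using ExteriorAlgebra.induction with
  | algebraMap r =>
    simp only [AlgHom.commutes]
    exact coordSmoothAt_superCoord_algebraMap x₀ contMDiffAt_const
  | ι w =>
    simp only [ExteriorAlgebra.map_apply_ι]
    exact coordSmoothAt_superCoord_ι h₀ (contMDiffAt_symm_section x₁ h₁ w)
  | mul a b ha hb =>
    simp only [map_mul]
    exact coordSmoothAt_superCoord_mul ha hb
  | add a b ha hb =>
    simp only [map_add]
    have h := CoordSmoothAt.add ha hb
    rw [← superCoord_add] at h
    exact h

theorem map_symm_eq_sum (x : M) {y : M} (hy : y ∈ (trivializationAt F S x).baseSet)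
    (f : Π x, ExteriorAlgebra 𝕜 (S x)) :
    f y = ∑ A, algebraMap 𝕜 _ ((finBasis 𝕜 F).ExteriorAlgebra.repr (superCoord F x f y) A) *
      ExteriorAlgebra.map ((trivializationAt F S x).symmₗ 𝕜 y)
        ((finBasis 𝕜 F).ExteriorAlgebra A) := by
  conv_lhs => rw [← map_symm_superCoord hy f,
    ← (finBasis 𝕜 F).ExteriorAlgebra.sum_repr (superCoord F x f y)]
  simp only [map_sum, map_smul]
  exact Finset.sum_congr rfl fun A _ => Algebra.smul_def _ _

theorem coordSmoothAt_sum {V : Type*} [AddCommGroup V] [Module 𝕜 V] {κ α : Type*} [Fintype κ]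
    {b : Basis κ 𝕜 V} (s : Finset α) {a : α → M → V} {x : M}
    (ha : ∀ i ∈ s, CoordSmoothAt I b (a i) x) :
    CoordSmoothAt I b (fun y => ∑ i ∈ s, a i y) x := fun k => by
  simp only [map_sum, Finsupp.finsetSum_apply]
  exact contMDiffAt_scalar_sum _ fun i hi => ha i hi k

theorem superCoord_congr {x₀ x : M} {f h : Π x, ExteriorAlgebra 𝕜 (S x)}
    (hfh : ∀ᶠ y in 𝓝 x, f y = h y) : superCoord F x₀ f =ᶠ[𝓝 x] superCoord F x₀ h :=
  hfh.mono fun y hy => by simp only [superCoord, hy]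

theorem coordSmoothAt_superCoord_change {x₀ x₁ y : M}
    (h₀ : y ∈ (trivializationAt F S x₀).baseSet) (h₁ : y ∈ (trivializationAt F S x₁).baseSet)
    {f : Π x, ExteriorAlgebra 𝕜 (S x)}
    (hf : CoordSmoothAt I (finBasis 𝕜 F).ExteriorAlgebra (superCoord F x₁ f) y) :
    CoordSmoothAt I (finBasis 𝕜 F).ExteriorAlgebra (superCoord F x₀ f) y := by
  have hdec : ∀ᶠ z in 𝓝 y, f z = ∑ A,
      algebraMap 𝕜 _ ((finBasis 𝕜 F).ExteriorAlgebra.repr (superCoord F x₁ f z) A) *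
        ExteriorAlgebra.map ((trivializationAt F S x₁).symmₗ 𝕜 z)
          ((finBasis 𝕜 F).ExteriorAlgebra A) := by
    filter_upwards [(trivializationAt F S x₁).open_baseSet.mem_nhds h₁] with z hz
    exact map_symm_eq_sum x₁ hz f
  refine CoordSmoothAt.congr ?_ (superCoord_congr hdec)
  have h : superCoord F x₀ (fun z => ∑ A,
      algebraMap 𝕜 _ ((finBasis 𝕜 F).ExteriorAlgebra.repr (superCoord F x₁ f z) A) *
        ExteriorAlgebra.map ((trivializationAt F S x₁).symmₗ 𝕜 z)
          ((finBasis 𝕜 F).ExteriorAlgebra A)) = fun z => ∑ A, superCoord F x₀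
      ((fun z => algebraMap 𝕜 _ ((finBasis 𝕜 F).ExteriorAlgebra.repr (superCoord F x₁ f z) A)) *
        (fun z => ExteriorAlgebra.map ((trivializationAt F S x₁).symmₗ 𝕜 z)
          ((finBasis 𝕜 F).ExteriorAlgebra A))) z := funext fun z => map_sum _ _ _
  rw [h]
  exact coordSmoothAt_sum _ fun A _ => coordSmoothAt_superCoord_mul
    (coordSmoothAt_superCoord_algebraMap x₀ (hf A)) (coordSmoothAt_superCoord_map_symm h₀ h₁ _)

theorem smul_eq_algebraMap_mul (c : 𝕜) (f : Π x, ExteriorAlgebra 𝕜 (S x)) :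
    c • f = (fun y => algebraMap 𝕜 (ExteriorAlgebra 𝕜 (S y)) c) * f :=
  funext fun y => Algebra.smul_def (A := ExteriorAlgebra 𝕜 (S y)) c (f y)

namespace SmoothSuperAt

variable {f h : Π x, ExteriorAlgebra 𝕜 (S x)} {x : M}

theorem add (hf : SmoothSuperAt I F f x) (hh : SmoothSuperAt I F h x) :
    SmoothSuperAt I F (f + h) x := by
  rw [SmoothSuperAt, superCoord_add]
  exact CoordSmoothAt.add hf hh

theorem mul (hf : SmoothSuperAt I F f x) (hh : SmoothSuperAt I F h x) :
    SmoothSuperAt I F (f * h) x := coordSmoothAt_superCoord_mul hf hh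

theorem of_scalar {a : M → 𝕜} (ha : ContMDiffAt I 𝓘(ℝ, 𝕜) ∞ a x) :
    SmoothSuperAt I F (fun y => algebraMap 𝕜 (ExteriorAlgebra 𝕜 (S y)) (a y)) x :=
  coordSmoothAt_superCoord_algebraMap x ha

theorem of_section {σ : Π x : M, S x}
    (hσ : ContMDiffAt I (I.prod 𝓘(ℝ, F)) ∞ (fun z ↦ TotalSpace.mk' F z (σ z)) x) :
    SmoothSuperAt I F (fun y => ExteriorAlgebra.ι 𝕜 (σ y)) x :=
  coordSmoothAt_superCoord_ι (FiberBundle.mem_baseSet_trivializationAt' x) hσ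

theorem congr (hf : SmoothSuperAt I F f x) (hfh : ∀ᶠ y in 𝓝 x, h y = f y) :
    SmoothSuperAt I F h x := CoordSmoothAt.congr hf (superCoord_congr hfh)

theorem zero : SmoothSuperAt I F (0 : Π x, ExteriorAlgebra 𝕜 (S x)) x := by
  have h := of_scalar (I := I) (F := F) (S := S) (x := x) (a := fun _ => (0 : 𝕜))
    contMDiffAt_const
  simp only [map_zero] at h
  exact h

theorem sum {α : Type*} (s : Finset α) {f : α → Π x, ExteriorAlgebra 𝕜 (S x)}
    (hf : ∀ i ∈ s, SmoothSuperAt I F (f i) x) :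
    SmoothSuperAt I F (fun y => ∑ i ∈ s, f i y) x := by
  classical
  induction s using Finset.induction_on with
  | empty => simpa using! zero
  | insert i s hi ih =>
    simp only [Finset.sum_insert hi]
    exact (hf i (Finset.mem_insert_self i s)).add
      (ih fun j hj => hf j (Finset.mem_insert_of_mem hj))

end SmoothSuperAt

section Derivative

variable [∀ x, IsTopologicalAddGroup (S x)] [∀ x, ContinuousSMul ℝ (S x)] [IsManifold I ∞ M]
  (D : SpinorConnection 𝕜 I F S) {f h : Π x, ExteriorAlgebra 𝕜 (S x)} {x : M}

theorem superD_eq (f : Π x, ExteriorAlgebra 𝕜 (S x)) (x : M) (v : TangentSpace I x) :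
    superD D f x v = ExteriorAlgebra.map ((trivializationAt F S x).symmₗ 𝕜 x)
        (coordDeriv (finBasis 𝕜 F).ExteriorAlgebra (superCoord F x f) x v)
      + derivOfEnd (connectionForm D x v) (f x) := by
  rw [superD, coordDeriv, map_sum]
  simp only [map_smul]
  rfl

theorem superD_congr (hfh : ∀ᶠ y in 𝓝 x, f y = h y) (v : TangentSpace I x) :
    superD D f x v = superD D h x v := by
  rw [superD_eq, superD_eq, coordDeriv_congr _ (superCoord_congr hfh), hfh.self_of_nhds]

theorem superD_add (hf : SmoothSuperAt I F f x) (hh : SmoothSuperAt I F h x)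
    (v : TangentSpace I x) : superD D (f + h) x v = superD D f x v + superD D h x v := by
  rw [superD_eq, superD_eq, superD_eq, superCoord_add, coordDeriv_add hf hh, map_add, Pi.add_apply,
    map_add]
  abel

theorem superD_mul (hf : SmoothSuperAt I F f x) (hh : SmoothSuperAt I F h x)
    (v : TangentSpace I x) :
    superD D (f * h) x v = superD D f x v * h x + f x * superD D h x v := by
  have hx : x ∈ (trivializationAt F S x).baseSet := FiberBundle.mem_baseSet_trivializationAt' x
  have h₁ := coordDeriv_bilin (finBasis 𝕜 F).ExteriorAlgebra
    (LinearMap.mul 𝕜 (ExteriorAlgebra 𝕜 F)) hf hh v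
  simp only [LinearMap.mul_apply'] at h₁
  rw [superD_eq, superD_eq, superD_eq, superCoord_mul, h₁, map_add, map_mul, map_mul,
    map_symm_superCoord hx, map_symm_superCoord hx, Pi.mul_apply, derivOfEnd_mul]
  noncomm_ring

theorem superD_algebraMap {a : M → 𝕜} (ha : ContMDiffAt I 𝓘(ℝ, 𝕜) ∞ a x)
    (v : TangentSpace I x) :
    superD D (fun y => algebraMap 𝕜 (ExteriorAlgebra 𝕜 (S y)) (a y)) x v
      = algebraMap 𝕜 _ (mvfderiv I a x v) := by
  rw [superD_eq, superCoord_algebraMap, coordDeriv_linear _ _ (coordSmoothAt_singleton ha),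
    coordDeriv_singleton, derivOfEnd_algebraMap, add_zero, Algebra.linearMap_apply,
    AlgHom.commutes]

theorem superD_ι {σ : Π x : M, S x}
    (hσ : ContMDiffAt I (I.prod 𝓘(ℝ, F)) ∞ (fun z ↦ TotalSpace.mk' F z (σ z)) x)
    (v : TangentSpace I x) :
    superD D (fun y => ExteriorAlgebra.ι 𝕜 (σ y)) x v
      = ExteriorAlgebra.ι 𝕜 (D.toFun σ x v) := by
  have hx : x ∈ (trivializationAt F S x).baseSet := FiberBundle.mem_baseSet_trivializationAt' x
  rw [superD_eq, superCoord_ι, coordDeriv_linear _ _ ((coordSmoothAt_section_iff hx).2 hσ),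
    derivOfEnd_ι, ExteriorAlgebra.map_apply_ι, ← map_add, D.apply_eq hσ]

theorem superD_const_smul (c : 𝕜) (hf : SmoothSuperAt I F f x) (v : TangentSpace I x) :
    superD D (c • f) x v = c • superD D f x v := by
  rw [smul_eq_algebraMap_mul, superD_mul D (SmoothSuperAt.of_scalar contMDiffAt_const) hf,
    superD_algebraMap D contMDiffAt_const, mvfderiv_const, Algebra.smul_def]
  simp

theorem superD_sum {α : Type*} (s : Finset α) {f : α → Π x, ExteriorAlgebra 𝕜 (S x)}
    (hf : ∀ i ∈ s, SmoothSuperAt I F (f i) x) (v : TangentSpace I x) :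
    superD D (fun y => ∑ i ∈ s, f i y) x v = ∑ i ∈ s, superD D (f i) x v := by
  classical
  induction s using Finset.induction_on with
  | empty =>
    simp only [Finset.sum_empty]
    have h := superD_const_smul D (0 : 𝕜) (SmoothSuperAt.zero (F := F) (x := x)) v
    rw [zero_smul, zero_smul] at h
    exact h
  | insert i s hi ih =>
    have h₂ := fun j hj => hf j (Finset.mem_insert_of_mem hj)
    simp only [Finset.sum_insert hi]
    rw [← ih h₂]
    exact superD_add D (hf i (Finset.mem_insert_self i s)) (SmoothSuperAt.sum s h₂) v

theorem connectionForm_add (x : M) (u v : TangentSpace I x) :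
    connectionForm D x (u + v) = connectionForm D x u + connectionForm D x v := by
  ext s
  exact map_add (D.toFun (localExt 𝕜 F s) x) u v

theorem connectionForm_smul (x : M) (r : ℝ) (v : TangentSpace I x) :
    connectionForm D x (r • v) = (r : 𝕜) • connectionForm D x v := by
  ext s
  rw [LinearMap.smul_apply, ofReal_smul_fibre 𝕜 F]
  exact map_smul (D.toFun (localExt 𝕜 F s) x) r v

theorem superD_add_vec (f : Π x, ExteriorAlgebra 𝕜 (S x)) (x : M) (u v : TangentSpace I x) :
    superD D f x (u + v) = superD D f x u + superD D f x v := by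
  rw [superD_eq, superD_eq, superD_eq, coordDeriv_add_vec, connectionForm_add, derivOfEnd_add_end,
    map_add]
  abel

theorem superD_smul_vec (f : Π x, ExteriorAlgebra 𝕜 (S x)) (x : M) (r : ℝ)
    (v : TangentSpace I x) : superD D f x (r • v) = (r : 𝕜) • superD D f x v := by
  rw [superD_eq, superD_eq, coordDeriv_smul_vec, connectionForm_smul, derivOfEnd_smul_end,
    map_smul, smul_add]

theorem superD_sum_vec (f : Π x, ExteriorAlgebra 𝕜 (S x)) (x : M) {α : Type*} (s : Finset α)
    (r : α → ℝ) (v : α → TangentSpace I x) :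
    superD D f x (∑ i ∈ s, r i • v i) = ∑ i ∈ s, (r i : 𝕜) • superD D f x (v i) := by
  classical
  induction s using Finset.induction_on with
  | empty => simpa using superD_smul_vec D f x 0 0
  | insert i s hi ih => rw [Finset.sum_insert hi, Finset.sum_insert hi, superD_add_vec,
      superD_smul_vec, ih]

/-- Covariant derivatives preserve the parity. -/
theorem superD_mem_evenOdd {p : ZMod 2} (hf : SmoothSuperAt I F f x) (hp : IsHomogeneous p f)
    (v : TangentSpace I x) :
    superD D f x v ∈ CliffordAlgebra.evenOdd (0 : QuadraticForm 𝕜 (S x)) p := by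
  rw [superD_eq]
  refine Submodule.add_mem _ (map_mem_evenOdd _ ?_) (derivOfEnd_mem_evenOdd _ (hp x))
  exact coordDeriv_mem _ _ hf (Filter.Eventually.of_forall fun y => map_mem_evenOdd _ (hp y)) v

end Derivative

end Superfunctions

/-! ### The Lie bracket as a commutator of derivations -/

section LieBracket

variable {𝕜 : Type*} [RCLike 𝕜]
  {E : Type*} [NormedAddCommGroup E] [NormedSpace ℝ E]
  {H : Type*} [TopologicalSpace H] {I : ModelWithCorners ℝ E H}
  {M : Type*} [TopologicalSpace M] [ChartedSpace H M] [IsManifold I ∞ M]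

theorem contMDiffAt_mvfderiv_apply {a : M → 𝕜} {Y : Π y : M, TangentSpace I y} {x : M}
    (ha : ContMDiffAt I 𝓘(ℝ, 𝕜) ∞ a x)
    (hY : ContMDiffAt I (I.prod 𝓘(ℝ, E)) ∞ (fun y ↦ TotalSpace.mk' E y (Y y)) x) :
    ContMDiffAt I 𝓘(ℝ, 𝕜) ∞ (fun y => mvfderiv I a y (Y y)) x := by
  have h := ContMDiffAt.mfderiv_const (m := ∞) ha (by simp)
  have h₁ := ContMDiffAt.clm_apply_of_inCoordinates (b₁ := id) (b₂ := a)
    (E₁ := (TangentSpace I : M → Type _)) (E₂ := (TangentSpace 𝓘(ℝ, 𝕜) : 𝕜 → Type _))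
    (ϕ := fun y => mfderiv I 𝓘(ℝ, 𝕜) a y) (v := Y) h hY ha
  rw [contMDiffAt_totalSpace] at h₁
  simpa [TangentBundle.trivializationAt_apply] using! h₁.2

variable [FiniteDimensional ℝ E]

open VectorField in
theorem mvfderiv_mlieBracket_real {a : M → ℝ} {X Y : Π y : M, TangentSpace I y} {U : Set M}
    (hU : IsOpen U) {x : M} (hx : x ∈ U) (ha : ContMDiffOn I 𝓘(ℝ, ℝ) ∞ a U)
    (hX : ContMDiffOn I (I.prod 𝓘(ℝ, E)) ∞ (fun y ↦ TotalSpace.mk' E y (X y)) U)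
    (hY : ContMDiffOn I (I.prod 𝓘(ℝ, E)) ∞ (fun y ↦ TotalSpace.mk' E y (Y y)) U) :
    mvfderiv I a x (mlieBracket I X Y x)
      = mvfderiv I (fun y => mvfderiv I a y (Y y)) x (X x)
        - mvfderiv I (fun y => mvfderiv I a y (X y)) x (Y x) := by
  have : CompleteSpace E := FiniteDimensional.complete ℝ E
  have : IsManifold I (minSmoothness ℝ 3) M :=
    IsManifold.of_le (n := ∞) (by simp; exact ENat.LEInfty.out)
  have : IsManifold I (∞ + 1) M := IsManifold.of_le (n := ∞) (by simp)
  have : IsManifold I (minSmoothness ℝ 2) M :=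
    IsManifold.of_le (n := ∞) (by simp; exact ENat.LEInfty.out)
  by_cases hE : ∃ w : TangentSpace I x, w ≠ 0
  swap
  · push Not at hE
    rw [hE (mlieBracket I X Y x), hE (X x), hE (Y x)]
    simp
  obtain ⟨w, hw⟩ := hE
  obtain ⟨U', hU', hx', hW'⟩ := exists_contMDiffOn_localExt (I := I) ℝ E w
  set W := localExt ℝ E w with hWdef
  have hWx : W x = w := localExt_self ℝ E w
  have hUx : ∀ᶠ y in 𝓝 x, y ∈ U ∩ U' := (hU.inter hU').mem_nhds ⟨hx, hx'⟩
  have da : ∀ y ∈ U ∩ U', ContMDiffAt I 𝓘(ℝ, ℝ) ∞ a y := fun y hy =>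
    ha.contMDiffAt (hU.mem_nhds hy.1)
  have dX : ∀ y ∈ U ∩ U', ContMDiffAt I (I.prod 𝓘(ℝ, E)) ∞ (fun y ↦ TotalSpace.mk' E y (X y)) y :=
    fun y hy => hX.contMDiffAt (hU.mem_nhds hy.1)
  have dY : ∀ y ∈ U ∩ U', ContMDiffAt I (I.prod 𝓘(ℝ, E)) ∞ (fun y ↦ TotalSpace.mk' E y (Y y)) y :=
    fun y hy => hY.contMDiffAt (hU.mem_nhds hy.1)
  have dW : ∀ y ∈ U ∩ U', ContMDiffAt I (I.prod 𝓘(ℝ, E)) ∞ (fun y ↦ TotalSpace.mk' E y (W y)) y :=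
    fun y hy => hW'.contMDiffAt (hU'.mem_nhds hy.2)
  have hxx : x ∈ U ∩ U' := ⟨hx, hx'⟩
  have hmin : minSmoothness ℝ 2 ≤ (∞ : WithTop ℕ∞) := by simp; exact ENat.LEInfty.out
  -- one of the two iterated brackets
  have key : ∀ X Y : (Π y : M, TangentSpace I y),
      ContMDiffAt I (I.prod 𝓘(ℝ, E)) ∞ (fun y ↦ TotalSpace.mk' E y (X y)) x →
      (∀ y ∈ U ∩ U', ContMDiffAt I (I.prod 𝓘(ℝ, E)) ∞ (fun y ↦ TotalSpace.mk' E y (Y y)) y) →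
      mlieBracket I X (mlieBracket I Y (a • W)) x
        = mvfderiv I (fun y => mvfderiv I a y (Y y)) x (X x) • w
          + mvfderiv I a x (Y x) • mlieBracket I X W x
          + (mvfderiv I a x (X x) • mlieBracket I Y W x
            + a x • mlieBracket I X (mlieBracket I Y W) x) := by
    intro X Y dX dY
    have h₁ : mlieBracket I Y (a • W) =ᶠ[𝓝 x]
        (fun y => mvfderiv I a y (Y y)) • W + a • mlieBracket I Y W := by
      filter_upwards [hUx] with y hy
      exact mlieBracket_smul_right ((da y hy).mdifferentiableAt (by simp))
        ((dW y hy).mdifferentiableAt (by simp))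
    have d₁ := (contMDiffAt_mvfderiv_apply (da x hxx) (dY x hxx)).mdifferentiableAt
      (n := ∞) (by simp)
    have d₂ : MDifferentiableAt I (I.prod 𝓘(ℝ, E))
        (fun y ↦ TotalSpace.mk' E y (mlieBracket I Y W y)) x :=
      (ContMDiffAt.mlieBracket_vectorField (n := ⊤) (m := ⊤) (dY x hxx) (dW x hxx)
        (by simp)).mdifferentiableAt (by simp)
    have d₃ := (dW x hxx).mdifferentiableAt (n := ∞) (by simp)
    have d₄ := (da x hxx).mdifferentiableAt (n := ∞) (by simp)
    rw [(Filter.EventuallyEq.refl _ X).mlieBracket_vectorField_eq h₁,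
      mlieBracket_add_right (d₁.smul_section d₃) (d₄.smul_section d₂),
      mlieBracket_smul_right d₁ d₃, mlieBracket_smul_right d₄ d₂, hWx]
  have hJ := leibniz_identity_mlieBracket_apply (I := I) (U := X) (V := Y) (W := W)
    ((dX x hxx).of_le hmin) ((dY x hxx).of_le hmin) ((dW x hxx).of_le hmin)
  have hJa := leibniz_identity_mlieBracket_apply (I := I) (U := X) (V := Y) (W := a • W)
    ((dX x hxx).of_le hmin) ((dY x hxx).of_le hmin)
    (((da x hxx).smul_section (dW x hxx)).of_le hmin)
  rw [key X Y (dX x hxx) dY, key Y X (dY x hxx) dX,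
    mlieBracket_smul_right ((da x hxx).mdifferentiableAt (n := ∞) (by simp))
      ((dW x hxx).mdifferentiableAt (n := ∞) (by simp)), hWx, hJ] at hJa
  have h0 : (mvfderiv I a x (mlieBracket I X Y x)
      - (mvfderiv I (fun y => mvfderiv I a y (Y y)) x (X x)
        - mvfderiv I (fun y => mvfderiv I a y (X y)) x (Y x))) • w = 0 := by
    rw [← sub_eq_zero] at hJa
    rw [← neg_eq_zero, ← hJa]
    module
  exact sub_eq_zero.1 ((smul_eq_zero.1 h0).resolve_right hw)

open VectorField in
theorem mvfderiv_mlieBracket {a : M → 𝕜} {X Y : Π y : M, TangentSpace I y} {U : Set M}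
    (hU : IsOpen U) {x : M} (hx : x ∈ U) (ha : ContMDiffOn I 𝓘(ℝ, 𝕜) ∞ a U)
    (hX : ContMDiffOn I (I.prod 𝓘(ℝ, E)) ∞ (fun y ↦ TotalSpace.mk' E y (X y)) U)
    (hY : ContMDiffOn I (I.prod 𝓘(ℝ, E)) ∞ (fun y ↦ TotalSpace.mk' E y (Y y)) U) :
    mvfderiv I a x (mlieBracket I X Y x)
      = mvfderiv I (fun y => mvfderiv I a y (Y y)) x (X x)
        - mvfderiv I (fun y => mvfderiv I a y (X y)) x (Y x) := by
  have da : ∀ y ∈ U, MDifferentiableAt I 𝓘(ℝ, 𝕜) a y := fun y hy =>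
    (ha.contMDiffAt (hU.mem_nhds hy)).mdifferentiableAt (by simp)
  have key : ∀ L : 𝕜 →L[ℝ] ℝ, L (mvfderiv I a x (mlieBracket I X Y x))
      = L (mvfderiv I (fun y => mvfderiv I a y (Y y)) x (X x)
        - mvfderiv I (fun y => mvfderiv I a y (X y)) x (Y x)) := by
    intro L
    have h := mvfderiv_mlieBracket_real hU hx (a := fun y => L (a y))
      (L.contDiff.contMDiff.comp_contMDiffOn ha) hX hY
    have h₁ : ∀ Z : (Π y : M, TangentSpace I y), ∀ Z' : TangentSpace I x,
        ContMDiffOn I (I.prod 𝓘(ℝ, E)) ∞ (fun y ↦ TotalSpace.mk' E y (Z y)) U →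
        mvfderiv I (fun y => mvfderiv I (fun y => L (a y)) y (Z y)) x Z'
          = L (mvfderiv I (fun y => mvfderiv I a y (Z y)) x Z') := by
      intro Z Z' hZ
      have h₂ := (contMDiffAt_mvfderiv_apply (ha.contMDiffAt (hU.mem_nhds hx))
        (hZ.contMDiffAt (hU.mem_nhds hx))).mdifferentiableAt (n := ∞) (by simp)
      rw [← mvfderiv_clm_comp L h₂]
      have h₃ : (fun y => mvfderiv I (fun y => L (a y)) y (Z y))
          =ᶠ[𝓝 x] fun y => L (mvfderiv I a y (Z y)) := by
        filter_upwards [hU.mem_nhds hx] with y hy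
        exact mvfderiv_clm_comp L (da y hy) _
      rw [mvfderiv_congr h₃]
    rwa [mvfderiv_clm_comp L (da x hx), h₁ Y _ hY, h₁ X _ hX, ← map_sub] at h
  apply RCLike.ext
  · exact key RCLike.reCLM
  · exact key RCLike.imCLM

end LieBracket

/-! ### Local generators of the algebra of superfunctions -/

section Generators

variable {𝕜 : Type*} [RCLike 𝕜]
  {E : Type*} [NormedAddCommGroup E] [NormedSpace ℝ E]
  {H : Type*} [TopologicalSpace H] {I : ModelWithCorners ℝ E H}
  {M : Type*} [TopologicalSpace M] [ChartedSpace H M]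
  {F : Type*} [NormedAddCommGroup F] [NormedSpace ℝ F] [NormedSpace 𝕜 F]
  {S : M → Type*} [TopologicalSpace (TotalSpace F S)]
  [∀ x, AddCommGroup (S x)] [∀ x, Module ℝ (S x)] [∀ x, Module 𝕜 (S x)]
  [∀ x, TopologicalSpace (S x)]
  [FiberBundle F S] [VectorBundle ℝ F S] [VectorBundle 𝕜 F S]
  [IsScalarTower ℝ 𝕜 F] [FiniteDimensional 𝕜 F] [ContMDiffVectorBundle ∞ F S I]

variable (I F) in
/-- The algebra generated by the smooth functions on `U` and the sections of `S` which have
constant coefficients in the preferred trivialization at `x`. -/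
inductive LocallyGenerated (x : M) (U : Set M) : (Π y, ExteriorAlgebra 𝕜 (S y)) → Prop
  | scalar (a : M → 𝕜) (ha : ContMDiffOn I 𝓘(ℝ, 𝕜) ∞ a U) :
      LocallyGenerated x U (fun y => algebraMap 𝕜 (ExteriorAlgebra 𝕜 (S y)) (a y))
  | vec (s : S x)
      (hs : ContMDiffOn I (I.prod 𝓘(ℝ, F)) ∞ (fun y ↦ TotalSpace.mk' F y (localExt 𝕜 F s y)) U) :
      LocallyGenerated x U (fun y => ExteriorAlgebra.ι 𝕜 (localExt 𝕜 F s y))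
  | add (f h : Π y, ExteriorAlgebra 𝕜 (S y)) (hf : LocallyGenerated x U f)
      (hh : LocallyGenerated x U h) : LocallyGenerated x U (f + h)
  | mul (f h : Π y, ExteriorAlgebra 𝕜 (S y)) (hf : LocallyGenerated x U f)
      (hh : LocallyGenerated x U h) : LocallyGenerated x U (f * h)

namespace LocallyGenerated

variable {x : M} {U : Set M} {f : Π y, ExteriorAlgebra 𝕜 (S y)}

theorem smoothSuperAt (hf : LocallyGenerated I F x U f) (hU : IsOpen U) {y : M} (hy : y ∈ U) :
    SmoothSuperAt I F f y := by
  induction hf with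
  | scalar a ha => exact SmoothSuperAt.of_scalar (ha.contMDiffAt (hU.mem_nhds hy))
  | vec s hs => exact SmoothSuperAt.of_section (hs.contMDiffAt (hU.mem_nhds hy))
  | add f h _ _ hf hh => exact hf.add hh
  | mul f h _ _ hf hh => exact hf.mul hh

theorem map_symm (hU : U ⊆ (trivializationAt F S x).baseSet)
    (a : ExteriorAlgebra 𝕜 F) : LocallyGenerated I F x U
      (fun y => ExteriorAlgebra.map ((trivializationAt F S x).symmₗ 𝕜 y) a) := by
  induction a using ExteriorAlgebra.induction with
  | algebraMap r =>
    simp only [AlgHom.commutes]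
    exact scalar (fun _ => r) contMDiffOn_const
  | ι w =>
    have hw : (fun y => ExteriorAlgebra.map ((trivializationAt F S x).symmₗ 𝕜 y)
        (ExteriorAlgebra.ι 𝕜 w)) = fun y => ExteriorAlgebra.ι 𝕜
          (localExt 𝕜 F ((trivializationAt F S x).symmₗ 𝕜 x w) y) := funext fun y => by
      rw [ExteriorAlgebra.map_apply_ι, localExt_symm]
    rw [hw]
    refine vec _ fun y hy => ?_
    simp only [localExt_symm]
    exact (contMDiffAt_symm_section x (hU hy) w).contMDiffWithinAt
  | mul a b ha hb =>
    simp only [map_mul]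
    exact ha.mul _ _ hb
  | add a b ha hb =>
    simp only [map_add]
    exact ha.add _ _ hb

theorem sum {α : Type*} (s : Finset α) {f : α → Π y, ExteriorAlgebra 𝕜 (S y)}
    (hf : ∀ i ∈ s, LocallyGenerated I F x U (f i)) :
    LocallyGenerated I F x U (fun y => ∑ i ∈ s, f i y) := by
  classical
  induction s using Finset.induction_on with
  | empty =>
    have h := scalar (I := I) (F := F) (S := S) (x := x) (U := U) (fun _ => (0 : 𝕜))
      contMDiffOn_const
    simpa only [map_zero, Finset.sum_empty] using h
  | insert i s hi ih =>
    simp only [Finset.sum_insert hi]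
    exact (hf i (Finset.mem_insert_self i s)).add _ _
      (ih fun j hj => hf j (Finset.mem_insert_of_mem hj))

/-- Smooth sections of `ΛS` are locally generated. -/
theorem exists_eqOn {V : Set M} (hV : IsOpen V) (hx : x ∈ V)
    (hf : ∀ y ∈ V, SmoothSuperAt I F f y) :
    ∃ (U : Set M) (h : Π y, ExteriorAlgebra 𝕜 (S y)), IsOpen U ∧ x ∈ U ∧ U ⊆ V ∧
      LocallyGenerated I F x U h ∧ ∀ y ∈ U, f y = h y := by
  have hxb : x ∈ (trivializationAt F S x).baseSet := FiberBundle.mem_baseSet_trivializationAt' x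
  refine ⟨V ∩ (trivializationAt F S x).baseSet, _, hV.inter (trivializationAt F S x).open_baseSet,
    ⟨hx, hxb⟩, Set.inter_subset_left, ?_, fun y hy => map_symm_eq_sum x hy.2 f⟩
  refine sum _ fun A _ => mul _ _ (scalar _ fun y hy => ?_) (map_symm Set.inter_subset_right _)
  exact (coordSmoothAt_superCoord_change hy.2 (FiberBundle.mem_baseSet_trivializationAt' y)
    (hf y hy.1) A).contMDiffWithinAt

variable [∀ x, IsTopologicalAddGroup (S x)] [∀ x, ContinuousSMul ℝ (S x)] [IsManifold I ∞ M]
  (D : SpinorConnection 𝕜 I F S)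

theorem smoothSuperAt_superD (hf : LocallyGenerated I F x U f) (hU : IsOpen U)
    {Y : Π y : M, TangentSpace I y}
    (hY : ContMDiffOn I (I.prod 𝓘(ℝ, E)) ∞ (fun y ↦ TotalSpace.mk' E y (Y y)) U)
    {y : M} (hy : y ∈ U) : SmoothSuperAt I F (fun z => superD D f z (Y z)) y := by
  have hUy := hU.mem_nhds hy
  induction hf with
  | scalar a ha =>
    refine (SmoothSuperAt.of_scalar (contMDiffAt_mvfderiv_apply (ha.contMDiffAt hUy)
      (hY.contMDiffAt hUy))).congr ?_
    filter_upwards [hUy] with z hz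
    exact superD_algebraMap D (ha.contMDiffAt (hU.mem_nhds hz)) _
  | vec s hs =>
    refine (SmoothSuperAt.of_section ((D.contMDiffOn_apply hU hs hY).contMDiffAt hUy)).congr ?_
    filter_upwards [hUy] with z hz
    exact superD_ι D (hs.contMDiffAt (hU.mem_nhds hz)) _
  | add f h hf hh ihf ihh =>
    refine (ihf.add ihh).congr ?_
    filter_upwards [hUy] with z hz
    exact superD_add D (hf.smoothSuperAt hU hz) (hh.smoothSuperAt hU hz) _
  | mul f h hf hh ihf ihh =>
    refine ((ihf.mul (hh.smoothSuperAt hU hy)).add ((hf.smoothSuperAt hU hy).mul ihh)).congr ?_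
    filter_upwards [hUy] with z hz
    exact superD_mul D (hf.smoothSuperAt hU hz) (hh.smoothSuperAt hU hz) _

/-- The commutator of covariant derivatives along coordinate extensions of two tangent vectors is
given by the curvature. -/
theorem superD_commutator [FiniteDimensional ℝ E] (hf : LocallyGenerated I F x U f) (hU : IsOpen U)
    (hx : x ∈ U) (u v : TangentSpace I x)
    (hu : ContMDiffOn I (I.prod 𝓘(ℝ, E)) ∞ (fun y ↦ TotalSpace.mk' E y (localExt ℝ E u y)) U)
    (hv : ContMDiffOn I (I.prod 𝓘(ℝ, E)) ∞ (fun y ↦ TotalSpace.mk' E y (localExt ℝ E v y)) U) :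
    superD D (fun y => superD D f y (localExt ℝ E v y)) x u
      - superD D (fun y => superD D f y (localExt ℝ E u y)) x v
      = superD D f x (VectorField.mlieBracket I (localExt ℝ E u) (localExt ℝ E v) x)
        + derivOfEnd (curvature D x u v) (f x) := by
  have hUx := hU.mem_nhds hx
  have hself : ∀ w : TangentSpace I x, localExt ℝ E w x = w := localExt_self ℝ E
  induction hf with
  | scalar a ha =>
    have h : ∀ w w' : TangentSpace I x,
        ContMDiffOn I (I.prod 𝓘(ℝ, E)) ∞ (fun y ↦ TotalSpace.mk' E y (localExt ℝ E w y)) U →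
        superD D (fun y => superD D (fun y => algebraMap 𝕜 (ExteriorAlgebra 𝕜 (S y)) (a y)) y
          (localExt ℝ E w y)) x w' = algebraMap 𝕜 _
            (mvfderiv I (fun y => mvfderiv I a y (localExt ℝ E w y)) x w') := by
      intro w w' hw
      rw [← superD_algebraMap D (contMDiffAt_mvfderiv_apply (ha.contMDiffAt hUx)
        (hw.contMDiffAt hUx))]
      refine superD_congr D ?_ _
      filter_upwards [hUx] with z hz
      exact superD_algebraMap D (ha.contMDiffAt (hU.mem_nhds hz)) _
    rw [h v u hv, h u v hu, superD_algebraMap D (ha.contMDiffAt hUx), derivOfEnd_algebraMap,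
      add_zero, mvfderiv_mlieBracket hU hx ha hu hv, map_sub, hself, hself]
  | vec s hs =>
    have h : ∀ w w' : TangentSpace I x,
        ContMDiffOn I (I.prod 𝓘(ℝ, E)) ∞ (fun y ↦ TotalSpace.mk' E y (localExt ℝ E w y)) U →
        superD D (fun y => superD D (fun y => ExteriorAlgebra.ι 𝕜 (localExt 𝕜 F s y)) y
          (localExt ℝ E w y)) x w' = ExteriorAlgebra.ι 𝕜
            (D.toFun (fun y => D.toFun (localExt 𝕜 F s) y (localExt ℝ E w y)) x w') := by
      intro w w' hw
      rw [← superD_ι D ((D.contMDiffOn_apply hU hs hw).contMDiffAt hUx)]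
      refine superD_congr D ?_ _
      filter_upwards [hUx] with z hz
      exact superD_ι D (hs.contMDiffAt (hU.mem_nhds hz)) _
    rw [h v u hv, h u v hu, superD_ι D (hs.contMDiffAt hUx), derivOfEnd_ι, localExt_self,
      ← map_sub, ← map_add]
    congr 1
    rw [curvature, LinearMap.coe_mk, AddHom.coe_mk]
    abel
  | add f h hf hh ihf ihh =>
    have h : ∀ w w' : TangentSpace I x,
        ContMDiffOn I (I.prod 𝓘(ℝ, E)) ∞ (fun y ↦ TotalSpace.mk' E y (localExt ℝ E w y)) U →
        superD D (fun y => superD D (f + h) y (localExt ℝ E w y)) x w'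
          = superD D (fun y => superD D f y (localExt ℝ E w y)) x w'
            + superD D (fun y => superD D h y (localExt ℝ E w y)) x w' := by
      intro w w' hw
      rw [← superD_add D (hf.smoothSuperAt_superD D hU hw hx) (hh.smoothSuperAt_superD D hU hw hx)]
      refine superD_congr D ?_ _
      filter_upwards [hUx] with z hz
      exact superD_add D (hf.smoothSuperAt hU hz) (hh.smoothSuperAt hU hz) _
    rw [h v u hv, h u v hu, superD_add D (hf.smoothSuperAt hU hx) (hh.smoothSuperAt hU hx),
      Pi.add_apply, map_add, add_sub_add_comm, ihf, ihh]
    abel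
  | mul f h hf hh ihf ihh =>
    have h₁ : ∀ w w' : TangentSpace I x,
        ContMDiffOn I (I.prod 𝓘(ℝ, E)) ∞ (fun y ↦ TotalSpace.mk' E y (localExt ℝ E w y)) U →
        superD D (fun y => superD D (f * h) y (localExt ℝ E w y)) x w'
          = superD D (fun y => superD D f y (localExt ℝ E w y)) x w' * h x
            + superD D f x w * superD D h x w'
            + (superD D f x w' * superD D h x w
              + f x * superD D (fun y => superD D h y (localExt ℝ E w y)) x w') := by
      intro w w' hw
      have k₁ := hf.smoothSuperAt_superD D hU hw hx
      have k₂ := hh.smoothSuperAt_superD D hU hw hx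
      have k₃ := hf.smoothSuperAt hU hx
      have k₄ := hh.smoothSuperAt hU hx
      have h₂ : ∀ᶠ y in 𝓝 x, superD D (f * h) y (localExt ℝ E w y)
          = ((fun y => superD D f y (localExt ℝ E w y)) * h
            + f * (fun y => superD D h y (localExt ℝ E w y))) y := by
        filter_upwards [hUx] with z hz
        exact superD_mul D (hf.smoothSuperAt hU hz) (hh.smoothSuperAt hU hz) _
      rw [superD_congr D h₂, superD_add D (k₁.mul k₄) (k₃.mul k₂), superD_mul D k₁ k₄,
        superD_mul D k₃ k₂, hself]
    rw [h₁ v u hv, h₁ u v hu, superD_mul D (hf.smoothSuperAt hU hx) (hh.smoothSuperAt hU hx),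
      Pi.mul_apply, derivOfEnd_mul]
    have e₁ := eq_add_of_sub_eq ihf
    have e₂ := eq_add_of_sub_eq ihh
    rw [e₁, e₂]
    noncomm_ring

end LocallyGenerated

section Consequences

variable [∀ x, IsTopologicalAddGroup (S x)] [∀ x, ContinuousSMul ℝ (S x)] [IsManifold I ∞ M]
  (D : SpinorConnection 𝕜 I F S) {f : Π y, ExteriorAlgebra 𝕜 (S y)} {U : Set M}

theorem smoothSuperAt_superD (hU : IsOpen U) (hf : ∀ y ∈ U, SmoothSuperAt I F f y)
    {Y : Π y : M, TangentSpace I y}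
    (hY : ContMDiffOn I (I.prod 𝓘(ℝ, E)) ∞ (fun y ↦ TotalSpace.mk' E y (Y y)) U)
    {y : M} (hy : y ∈ U) : SmoothSuperAt I F (fun z => superD D f z (Y z)) y := by
  obtain ⟨V, h, hV, hyV, hVU, hh, hfh⟩ := LocallyGenerated.exists_eqOn hU hy hf
  refine (hh.smoothSuperAt_superD D hV (hY.mono hVU) hyV).congr ?_
  filter_upwards [hV.mem_nhds hyV] with z hz
  refine superD_congr D ?_ _
  filter_upwards [hV.mem_nhds hz] with w hw using hfh w hw

theorem superD_commutator [FiniteDimensional ℝ E] (hU : IsOpen U)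
    (hf : ∀ y ∈ U, SmoothSuperAt I F f y) {x : M} (hx : x ∈ U) (u v : TangentSpace I x)
    (hu : ContMDiffOn I (I.prod 𝓘(ℝ, E)) ∞ (fun y ↦ TotalSpace.mk' E y (localExt ℝ E u y)) U)
    (hv : ContMDiffOn I (I.prod 𝓘(ℝ, E)) ∞ (fun y ↦ TotalSpace.mk' E y (localExt ℝ E v y)) U) :
    superD D (fun y => superD D f y (localExt ℝ E v y)) x u
      - superD D (fun y => superD D f y (localExt ℝ E u y)) x v
      = superD D f x (VectorField.mlieBracket I (localExt ℝ E u) (localExt ℝ E v) x)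
        + derivOfEnd (curvature D x u v) (f x) := by
  obtain ⟨V, h, hV, hxV, hVU, hh, hfh⟩ := LocallyGenerated.exists_eqOn hU hx hf
  have hloc : ∀ y ∈ V, ∀ᶠ z in 𝓝 y, f z = h z := fun y hy => by
    filter_upwards [hV.mem_nhds hy] with w hw using hfh w hw
  have h₁ : ∀ w w' : TangentSpace I x, superD D (fun y => superD D f y (localExt ℝ E w y)) x w'
      = superD D (fun y => superD D h y (localExt ℝ E w y)) x w' := by
    intro w w'
    refine superD_congr D ?_ _
    filter_upwards [hV.mem_nhds hxV] with z hz
    exact superD_congr D (hloc z hz) _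
  rw [h₁, h₁, superD_congr D (hloc x hxV), hfh x hxV]
  exact hh.superD_commutator D hV hxV u v (hu.mono hVU) (hv.mono hVU)

end Consequences

end Generators

/-! ### Dual frames -/

section Frames

variable {𝕜 : Type*} [RCLike 𝕜]
  {E : Type*} [NormedAddCommGroup E] [NormedSpace ℝ E]
  {H : Type*} [TopologicalSpace H] {I : ModelWithCorners ℝ E H}
  {M : Type*} [TopologicalSpace M] [ChartedSpace H M] [IsManifold I ∞ M]
  (g : PseudoRiemannianMetric I M) {ι : Type*} [Fintype ι] [DecidableEq ι]

theorem PseudoRiemannianMetric.sum_raise_smul {x : M} (e : Basis ι ℝ (TangentSpace I x))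
    (w : TangentSpace I x) : ∑ ν, g.val x (g.raise e ν) w • e ν = w := by
  have h : ∀ ν, g.val x (g.raise e ν) w = e.repr w ν := by
    intro ν
    conv_lhs => rw [← e.sum_repr w]
    simp only [map_sum, map_smul, g.val_raise, smul_eq_mul, mul_ite, mul_one, mul_zero]
    simp
  simp only [h, e.sum_repr]

theorem PseudoRiemannianMetric.sum_smul_raise {x : M} (e : Basis ι ℝ (TangentSpace I x))
    (w : TangentSpace I x) : ∑ ν, g.val x w (e ν) • g.raise e ν = w := by
  rw [← sub_eq_zero]
  apply g.nondegenerate x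
  intro v
  have h : ∀ μ, g.val x (∑ ν, g.val x w (e ν) • g.raise e ν - w) (e μ) = 0 := by
    intro μ
    simp only [map_sub, map_sum, map_smul, sub_apply, sum_apply,
      smul_apply, g.val_raise, smul_eq_mul, mul_ite, mul_one, mul_zero]
    simp
  rw [← e.sum_repr v, map_sum]
  exact Finset.sum_eq_zero fun μ _ => by rw [map_smul, h, smul_zero]

/-- The contraction `∑ p(e^μ) A(e_μ)` does not depend on the basis. -/
theorem PseudoRiemannianMetric.contraction_eq {Λ : Type*} [Ring Λ] [Algebra 𝕜 Λ] {x : M}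
    (e e' : Basis ι ℝ (TangentSpace I x)) (p A : TangentSpace I x → Λ)
    (hp : ∀ (r : ι → ℝ) (v : ι → TangentSpace I x),
      p (∑ i, r i • v i) = ∑ i, (r i : 𝕜) • p (v i))
    (hA : ∀ (r : ι → ℝ) (v : ι → TangentSpace I x),
      A (∑ i, r i • v i) = ∑ i, (r i : 𝕜) • A (v i)) :
    ∑ μ, p (g.raise e μ) * A (e μ) = ∑ μ, p (g.raise e' μ) * A (e' μ) := by
  have h₁ : ∀ μ, A (e μ) = ∑ ν, (g.val x (g.raise e' ν) (e μ) : 𝕜) • A (e' ν) := fun μ => by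
    rw [← hA, g.sum_raise_smul]
  have h₂ : ∀ ν, p (g.raise e' ν) = ∑ μ, (g.val x (g.raise e' ν) (e μ) : 𝕜) • p (g.raise e μ) :=
    fun ν => by rw [← hp, g.sum_smul_raise]
  simp only [h₁, h₂, Finset.mul_sum, Finset.sum_mul, mul_smul_comm, smul_mul_assoc]
  exact Finset.sum_comm

theorem PseudoRiemannianMetric.contraction_flip {Λ : Type*} [Ring Λ] [Algebra 𝕜 Λ] {x : M}
    (e : Basis ι ℝ (TangentSpace I x)) (p A : TangentSpace I x → Λ)
    (hp : ∀ (r : ι → ℝ) (v : ι → TangentSpace I x),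
      p (∑ i, r i • v i) = ∑ i, (r i : 𝕜) • p (v i))
    (hA : ∀ (r : ι → ℝ) (v : ι → TangentSpace I x),
      A (∑ i, r i • v i) = ∑ i, (r i : 𝕜) • A (v i)) :
    ∑ μ, p (g.raise e μ) * A (e μ) = ∑ μ, p (e μ) * A (g.raise e μ) := by
  have h₁ : ∀ ν, p (g.raise e ν)
      = ∑ μ, (g.val x (g.raise e μ) (g.raise e ν) : 𝕜) • p (e μ) :=
    fun ν => by rw [← hp, g.sum_raise_smul]
  have h₂ : ∀ μ, A (g.raise e μ)
      = ∑ ν, (g.val x (g.raise e μ) (g.raise e ν) : 𝕜) • A (e ν) := fun μ => by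
    rw [← hA]
    conv_lhs => rw [← g.sum_raise_smul e (g.raise e μ)]
    simp only [g.symm x (g.raise e μ)]
  simp only [h₁, h₂, Finset.mul_sum, Finset.sum_mul, mul_smul_comm, smul_mul_assoc]
  exact Finset.sum_comm

theorem contMDiffAt_metric {X Y : Π y : M, TangentSpace I y} {x : M}
    (hX : ContMDiffAt I (I.prod 𝓘(ℝ, E)) ∞ (fun y ↦ TotalSpace.mk' E y (X y)) x)
    (hY : ContMDiffAt I (I.prod 𝓘(ℝ, E)) ∞ (fun y ↦ TotalSpace.mk' E y (Y y)) x) :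
    ContMDiffAt I 𝓘(ℝ, ℝ) ∞ (fun y => g.val y (X y) (Y y)) x := by
  have h : ContMDiffAt I (I.prod 𝓘(ℝ, ℝ)) ∞
      (fun y ↦ TotalSpace.mk' ℝ (E := Bundle.Trivial M ℝ) y (g.val y (X y) (Y y))) x :=
    ContMDiffAt.clm_bundle_apply₂ (F₁ := E) (F₂ := E) (g.contMDiff x) hX hY
  simpa using (contMDiffAt_totalSpace.1 h).2

theorem contMDiffAt_det {A : M → Matrix ι ι ℝ} {x : M}
    (hA : ∀ i j, ContMDiffAt I 𝓘(ℝ, ℝ) ∞ (fun y => A y i j) x) :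
    ContMDiffAt I 𝓘(ℝ, ℝ) ∞ (fun y => (A y).det) x := by
  simp only [Matrix.det_apply']
  refine contMDiffAt_scalar_sum _ fun σ _ => contMDiffAt_scalar_mul contMDiffAt_const ?_
  exact contMDiffAt_finsetProd fun i _ => hA _ _

theorem contMDiffAt_matrix_inv {A : M → Matrix ι ι ℝ} {x : M}
    (hA : ∀ i j, ContMDiffAt I 𝓘(ℝ, ℝ) ∞ (fun y => A y i j) x) (hx : (A x).det ≠ 0) (i j : ι) :
    ContMDiffAt I 𝓘(ℝ, ℝ) ∞ (fun y => (A y)⁻¹ i j) x := by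
  simp only [Matrix.inv_def, Ring.inverse_eq_inv', Matrix.smul_apply, smul_eq_mul,
    Matrix.adjugate_apply]
  refine contMDiffAt_scalar_mul ?_ (contMDiffAt_det fun k l => ?_)
  · exact (contDiffAt_inv ℝ hx).contMDiffAt.comp x (contMDiffAt_det hA)
  · simp only [Matrix.updateRow_apply]
    split_ifs
    · exact contMDiffAt_const
    · exact hA k l

/-- The dual frame of a smooth frame is smooth. -/
theorem contMDiffAt_raise (b : ∀ y : M, Basis ι ℝ (TangentSpace I y)) {x : M}
    (hb : ∀ μ, ContMDiffAt I (I.prod 𝓘(ℝ, E)) ∞ (fun y ↦ TotalSpace.mk' E y (b y μ)) x) (μ : ι) :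
    ContMDiffAt I (I.prod 𝓘(ℝ, E)) ∞ (fun y ↦ TotalSpace.mk' E y (g.raise (b y) μ)) x := by
  let G : M → Matrix ι ι ℝ := fun y => Matrix.of fun μ ν => g.val y (b y μ) (b y ν)
  let c : M → Matrix ι ι ℝ := fun y =>
    Matrix.of fun μ ν => g.val y (g.raise (b y) ν) (g.raise (b y) μ)
  have hraise : ∀ y μ, g.raise (b y) μ = ∑ ν, c y μ ν • b y ν := fun y μ =>
    (g.sum_raise_smul (b y) (g.raise (b y) μ)).symm
  have hcG : ∀ y, c y * G y = 1 := by
    intro y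
    ext μ ν
    have h := congrArg (fun w => g.val y w (b y ν)) (hraise y μ)
    simp only [map_sum, map_smul, sum_apply, smul_apply, smul_eq_mul, g.val_raise] at h
    rw [Matrix.mul_apply, Matrix.one_apply]
    refine h.symm.trans ?_
    simp only [eq_comm]
  have hc : ∀ y, c y = (G y)⁻¹ := fun y => (Matrix.inv_eq_left_inv (hcG y)).symm
  have hdet : (G x).det ≠ 0 := fun h => by
    have h' := congrArg Matrix.det (hcG x)
    rw [Matrix.det_mul, h, mul_zero, Matrix.det_one] at h'
    exact zero_ne_one h'
  have hcs : ∀ μ ν, ContMDiffAt I 𝓘(ℝ, ℝ) ∞ (fun y => c y μ ν) x := by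
    intro μ ν
    simp only [hc]
    exact contMDiffAt_matrix_inv (fun i j => contMDiffAt_metric g (hb i) (hb j)) hdet μ ν
  simp only [hraise]
  exact ContMDiffAt.sum_section fun ν _ => (hcs μ ν).smul_section (hb ν)

theorem IsLeviCivita.nabla_raise {g}
    {nabla : CovariantDerivative I E (TangentSpace I : M → Type _)} (hnabla : IsLeviCivita g nabla)
    (b : ∀ y : M, Basis ι ℝ (TangentSpace I y)) {x : M}
    (hb : ∀ μ, ContMDiffAt I (I.prod 𝓘(ℝ, E)) ∞ (fun y ↦ TotalSpace.mk' E y (b y μ)) x) (μ : ι)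
    (v : TangentSpace I x) :
    nabla (fun y => g.raise (b y) μ) x v
      = -∑ l, g.val x (g.raise (b x) μ) (nabla (fun y => b y l) x v) • g.raise (b x) l := by
  conv_lhs => rw [← g.sum_smul_raise (b x) (nabla (fun y => g.raise (b y) μ) x v)]
  rw [← Finset.sum_neg_distrib]
  refine Finset.sum_congr rfl fun l _ => ?_
  have h := hnabla.metric x v (fun y => g.raise (b y) μ) (fun y => b y l)
    ((contMDiffAt_raise g b hb μ).mdifferentiableAt (by simp)) ((hb l).mdifferentiableAt (by simp))
  simp only [g.val_raise] at h
  rw [mvfderiv_const, zero_apply] at h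
  rw [← neg_smul, eq_neg_of_add_eq_zero_left h.symm]

variable (I) in
/-- The basis of `T_y M` with constant coefficients in the preferred trivialization at `x`, if
`y` is in its domain. -/
def localFrame (e : ∀ x : M, Basis ι ℝ (TangentSpace I x)) (x y : M) :
    Basis ι ℝ (TangentSpace I y) :=
  open Classical in
  if hy : y ∈ (trivializationAt E (TangentSpace I) x).baseSet then
    ((e x).map ((trivializationAt E (TangentSpace I) x).linearEquivAt ℝ x
      (FiberBundle.mem_baseSet_trivializationAt' x))).map
      ((trivializationAt E (TangentSpace I) x).linearEquivAt ℝ y hy).symm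
  else e y

theorem localFrame_apply (e : ∀ x : M, Basis ι ℝ (TangentSpace I x)) {x y : M}
    (hy : y ∈ (trivializationAt E (TangentSpace I) x).baseSet) (μ : ι) :
    localFrame I e x y μ = localExt ℝ E (e x μ) y := by
  rw [localFrame, dif_pos hy, localExt, Trivialization.coe_symmₗ _ hy,
    Trivialization.coe_linearMapAt_of_mem _ (FiberBundle.mem_baseSet_trivializationAt' x)]
  rfl

theorem localFrame_self (e : ∀ x : M, Basis ι ℝ (TangentSpace I x)) (x : M) :
    localFrame I e x x = e x := by
  ext μ
  rw [localFrame_apply e (FiberBundle.mem_baseSet_trivializationAt' x), localExt_self]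

theorem contMDiffOn_localExt [FiniteDimensional ℝ E] (x : M) (v : TangentSpace I x) :
    ContMDiffOn I (I.prod 𝓘(ℝ, E)) ∞ (fun y ↦ TotalSpace.mk' E y (localExt ℝ E v y))
      (trivializationAt E (TangentSpace I : M → Type _) x).baseSet := fun _ hy =>
  (contMDiffAt_symm_section (𝕜 := ℝ) (S := (TangentSpace I : M → Type _)) x hy
    _).contMDiffWithinAt

theorem contMDiffOn_localFrame [FiniteDimensional ℝ E]
    (e : ∀ x : M, Basis ι ℝ (TangentSpace I x)) (x : M) (μ : ι) :
    ContMDiffOn I (I.prod 𝓘(ℝ, E)) ∞ (fun y ↦ TotalSpace.mk' E y (localFrame I e x y μ))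
      (trivializationAt E (TangentSpace I : M → Type _) x).baseSet :=
  (contMDiffOn_localExt x (e x μ)).congr fun y hy => by rw [localFrame_apply e hy]

end Frames

/-! ### Tensoriality of `D̂γ` -/

section Tensoriality

variable {𝕜 : Type*} [RCLike 𝕜]
  {E : Type*} [NormedAddCommGroup E] [NormedSpace ℝ E] [FiniteDimensional ℝ E]
  {H : Type*} [TopologicalSpace H] {I : ModelWithCorners ℝ E H}
  {M : Type*} [TopologicalSpace M] [ChartedSpace H M] [IsManifold I ∞ M]
  {F : Type*} [NormedAddCommGroup F] [NormedSpace ℝ F] [NormedSpace 𝕜 F]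
  [IsScalarTower ℝ 𝕜 F] [FiniteDimensional 𝕜 F]
  {S : M → Type*} [TopologicalSpace (TotalSpace F S)]
  [∀ x, AddCommGroup (S x)] [∀ x, Module ℝ (S x)] [∀ x, Module 𝕜 (S x)]
  [∀ x, TopologicalSpace (S x)] [∀ x, IsTopologicalAddGroup (S x)]
  [∀ x, ContinuousSMul ℝ (S x)]
  [FiberBundle F S] [VectorBundle ℝ F S] [VectorBundle 𝕜 F S] [ContMDiffVectorBundle ∞ F S I]
  {g : PseudoRiemannianMetric I M} (γ : CliffordMultiplication 𝕜 F S g)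
  (nabla : CovariantDerivative I E (TangentSpace I : M → Type _))
  (D DC : SpinorConnection 𝕜 I F S)

theorem mdifferentiableAt_clifford_section {x : M} {Y : Π y : M, TangentSpace I y}
    {ξ : Π y : M, S y}
    (hY : MDifferentiableAt I (I.prod 𝓘(ℝ, E)) (fun y ↦ TotalSpace.mk' E y (Y y)) x)
    (hξ : MDifferentiableAt I (I.prod 𝓘(ℝ, F)) (fun y ↦ TotalSpace.mk' F y (ξ y)) x) :
    MDifferentiableAt I (I.prod 𝓘(ℝ, F)) (fun y ↦ TotalSpace.mk' F y (γ.val y (Y y) (ξ y))) x :=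
  MDifferentiableAt.clm_bundle_apply₂ (F₁ := E) (F₂ := F)
    ((γ.contMDiff x).mdifferentiableAt (by simp)) hY hξ

theorem contMDiffAt_clifford_section {x : M} {Y : Π y : M, TangentSpace I y}
    {ξ : Π y : M, S y}
    (hY : ContMDiffAt I (I.prod 𝓘(ℝ, E)) ∞ (fun y ↦ TotalSpace.mk' E y (Y y)) x)
    (hξ : ContMDiffAt I (I.prod 𝓘(ℝ, F)) ∞ (fun y ↦ TotalSpace.mk' F y (ξ y)) x) :
    ContMDiffAt I (I.prod 𝓘(ℝ, F)) ∞ (fun y ↦ TotalSpace.mk' F y (γ.val y (Y y) (ξ y))) x :=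
  ContMDiffAt.clm_bundle_apply₂ (F₁ := E) (F₂ := F) (γ.contMDiff x) hY hξ

/-- `(D̂_u γ)(Y)ξ` may be computed with arbitrary extensions `Y` and `ξ`. -/
theorem hatDgamma_apply {x : M} (u : TangentSpace I x) {Y : Π y : M, TangentSpace I y}
    {ξ : Π y : M, S y}
    (hY : MDifferentiableAt I (I.prod 𝓘(ℝ, E)) (fun y ↦ TotalSpace.mk' E y (Y y)) x)
    (hξ : MDifferentiableAt I (I.prod 𝓘(ℝ, F)) (fun y ↦ TotalSpace.mk' F y (ξ y)) x) :
    hatDgamma γ nabla D DC x u (Y x) (ξ x)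
      = D.toFun (fun y => γ.val y (Y y) (ξ y)) x u - γ.val x (nabla Y x u) (ξ x)
        - γ.val x (Y x) (DC.toFun ξ x u) := by
  have : FiniteDimensional ℝ F := FiniteDimensional.trans ℝ 𝕜 F
  have : ContMDiffVectorBundle 1 F S I := ContMDiffVectorBundle.of_le (n := ∞) (by simp)
  have hD := D.isCovariantDerivativeOnUniv
  have hDC := DC.isCovariantDerivativeOnUniv
  have hn := nabla.isCovariantDerivativeOnUniv
  let Φ : (Π y : M, TangentSpace I y) → (Π y : M, S y) → S x := fun Y ξ =>
    D.toFun (fun y => γ.val y (Y y) (ξ y)) x u - γ.val x (nabla Y x u) (ξ x)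
        - γ.val x (Y x) (DC.toFun ξ x u)
  have h := TensorialAt.pointwise₂ (I := I) (F := E) (F' := F) (Φ := Φ) (x := x) ?_ ?_ hY
    (mdifferentiableAt_localExt ℝ E (Y x)) hξ (mdifferentiableAt_localExt 𝕜 F (ξ x))
    (localExt_self ℝ E _).symm (localExt_self 𝕜 F _).symm
  · refine Eq.trans ?_ h.symm
    simp only [Φ, localExt_self]
    rfl
  · intro τ hτ
    constructor
    · intro f Y hf hY
      have h₁ : (fun y => γ.val y ((f • Y) y) (τ y)) = f • fun y => γ.val y (Y y) (τ y) := by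
        funext y
        simp
      simp only [Φ]
      rw [h₁, hD.leibniz (mdifferentiableAt_clifford_section γ hY hτ) hf,
        show nabla (f • Y) x = _ from hn.leibniz hY hf]
      simp only [add_apply, smul_apply, ContinuousLinearMap.smulRight_apply, map_add, map_smul,
        Pi.smul_apply']
      module
    · intro Y Y' hY hY'
      have h₁ : (fun y => γ.val y ((Y + Y') y) (τ y))
          = (fun y => γ.val y (Y y) (τ y)) + fun y => γ.val y (Y' y) (τ y) := by
        funext y
        simp
      simp only [Φ]
      rw [h₁, hD.add (mdifferentiableAt_clifford_section γ hY hτ)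
        (mdifferentiableAt_clifford_section γ hY' hτ),
        show nabla (Y + Y') x = _ from hn.add hY hY']
      simp only [add_apply, map_add, Pi.add_apply]
      abel
  · intro Y hY
    constructor
    · intro f τ hf hτ
      have h₁ : (fun y => γ.val y (Y y) ((f • τ) y)) = f • fun y => γ.val y (Y y) (τ y) := by
        funext y
        simp
      simp only [Φ]
      rw [h₁, hD.leibniz (mdifferentiableAt_clifford_section γ hY hτ) hf, hDC.leibniz hτ hf]
      simp only [add_apply, smul_apply, ContinuousLinearMap.smulRight_apply, map_add, map_smul,
        Pi.smul_apply']
      module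
    · intro τ τ' hτ hτ'
      have h₁ : (fun y => γ.val y (Y y) ((τ + τ') y))
          = (fun y => γ.val y (Y y) (τ y)) + fun y => γ.val y (Y y) (τ' y) := by
        funext y
        simp
      simp only [Φ]
      rw [h₁, hD.add (mdifferentiableAt_clifford_section γ hY hτ)
        (mdifferentiableAt_clifford_section γ hY hτ'), hDC.add hτ hτ']
      simp only [add_apply, map_add, Pi.add_apply]
      abel

theorem hatDgamma_add (x : M) (u v w : TangentSpace I x) (s : S x) :
    hatDgamma γ nabla D DC x u (v + w) s
      = hatDgamma γ nabla D DC x u v s + hatDgamma γ nabla D DC x u w s := by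
  have h : (fun y => γ.val y (localExt ℝ E (v + w) y) (localExt 𝕜 F s y))
      = (fun y => γ.val y (localExt ℝ E v y) (localExt 𝕜 F s y))
        + fun y => γ.val y (localExt ℝ E w y) (localExt 𝕜 F s y) := by
    funext y
    simp [localExt_add]
  simp only [hatDgamma, LinearMap.coe_mk, AddHom.coe_mk]
  rw [h, D.isCovariantDerivativeOnUniv.add (mdifferentiableAt_clifford γ v s)
    (mdifferentiableAt_clifford γ w s), localExt_add,
    show nabla (localExt ℝ E v + localExt ℝ E w) x = _ from nabla.isCovariantDerivativeOnUniv.add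
      (mdifferentiableAt_localExt ℝ E v) (mdifferentiableAt_localExt ℝ E w)]
  simp only [add_apply, map_add]
  abel

theorem hatDgamma_smul (x : M) (r : ℝ) (u v : TangentSpace I x) (s : S x) :
    hatDgamma γ nabla D DC x u (r • v) s = r • hatDgamma γ nabla D DC x u v s := by
  have h : (fun y => γ.val y (localExt ℝ E (r • v) y) (localExt 𝕜 F s y))
      = r • fun y => γ.val y (localExt ℝ E v y) (localExt 𝕜 F s y) := by
    funext y
    simp [localExt_smul]
  simp only [hatDgamma, LinearMap.coe_mk, AddHom.coe_mk]
  rw [h, D.isCovariantDerivativeOnUniv.smul_const r (mdifferentiableAt_clifford γ v s),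
    localExt_smul, show nabla (r • localExt ℝ E v) x = _ from
      nabla.isCovariantDerivativeOnUniv.smul_const r (mdifferentiableAt_localExt ℝ E v)]
  simp only [smul_apply, map_smul, smul_sub]

/-- The torsion as a linear map in its second argument. -/
def torsionLin (x : M) (u : TangentSpace I x) (s : S x) : TangentSpace I x →ₗ[ℝ] S x where
  toFun v := torsion γ nabla D DC x u v s
  map_add' v w := by
    simp only [torsion, LinearMap.sub_apply, hatDgamma_add]
    simp only [hatDgamma, LinearMap.coe_mk, AddHom.coe_mk, map_add, add_apply]
    abel
  map_smul' r v := by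
    simp only [torsion, LinearMap.sub_apply, hatDgamma_smul, RingHom.id_apply]
    simp only [hatDgamma, LinearMap.coe_mk, AddHom.coe_mk, map_smul, smul_apply, smul_sub]

theorem hatDgamma_eq_half_torsion {K : Set (ContMDiffSection I F ∞ S)}
    (hadm : IsAdmissible γ nabla D DC K) {η : ContMDiffSection I F ∞ S} (hη : η ∈ K) (x : M)
    (u v : TangentSpace I x) :
    hatDgamma γ nabla D DC x u v (η x)
      = (1 / 2 : 𝕜) • torsion γ nabla D DC x u v (η x) := by
  have h := hadm η hη x u v
  rw [LinearMap.add_apply] at h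
  rw [torsion, LinearMap.sub_apply, eq_neg_of_add_eq_zero_right h, sub_neg_eq_add, ← two_smul 𝕜,
    smul_smul]
  norm_num

theorem ι_torsion_sum_smul (x : M) (u : TangentSpace I x) (s : S x) {α : Type*} [Fintype α]
    (r : α → ℝ) (v : α → TangentSpace I x) :
    ExteriorAlgebra.ι 𝕜 (torsion γ nabla D DC x u (∑ i, r i • v i) s)
      = ∑ i, (r i : 𝕜) • ExteriorAlgebra.ι 𝕜 (torsion γ nabla D DC x u (v i) s) := by
  have h := map_sum (torsionLin γ nabla D DC x u s) (fun i => r i • v i) Finset.univ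
  refine (congrArg (ExteriorAlgebra.ι 𝕜) h).trans ?_
  rw [map_sum]
  refine Finset.sum_congr rfl fun i _ => ?_
  rw [(torsionLin γ nabla D DC x u s).map_smul, ← ofReal_smul_fibre 𝕜 F x, LinearMap.map_smul]
  rfl

theorem ι_clifford_sum_smul (x : M) (s : S x) {α : Type*} [Fintype α]
    (r : α → ℝ) (v : α → TangentSpace I x) :
    ExteriorAlgebra.ι 𝕜 (γ.val x (∑ i, r i • v i) s)
      = ∑ i, (r i : 𝕜) • ExteriorAlgebra.ι 𝕜 (γ.val x (v i) s) := by
  simp only [map_sum, _root_.map_smul, sum_apply, smul_apply, ← ofReal_smul_fibre 𝕜 F x]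

end Tensoriality

/-! ### The vector fields `ı(φ)` and their supercommutators -/

section SuperVectorField

variable {𝕜 : Type*} [RCLike 𝕜]
  {E : Type*} [NormedAddCommGroup E] [NormedSpace ℝ E] [FiniteDimensional ℝ E]
  {H : Type*} [TopologicalSpace H] {I : ModelWithCorners ℝ E H}
  {M : Type*} [TopologicalSpace M] [ChartedSpace H M] [IsManifold I ∞ M]
  {F : Type*} [NormedAddCommGroup F] [NormedSpace ℝ F] [NormedSpace 𝕜 F]
  [IsScalarTower ℝ 𝕜 F] [FiniteDimensional 𝕜 F]
  {S : M → Type*} [TopologicalSpace (TotalSpace F S)]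
  [∀ x, AddCommGroup (S x)] [∀ x, Module ℝ (S x)] [∀ x, Module 𝕜 (S x)]
  [∀ x, TopologicalSpace (S x)] [∀ x, IsTopologicalAddGroup (S x)]
  [∀ x, ContinuousSMul ℝ (S x)]
  [FiberBundle F S] [VectorBundle ℝ F S] [VectorBundle 𝕜 F S] [ContMDiffVectorBundle ∞ F S I]
  {g : PseudoRiemannianMetric I M} (γ : CliffordMultiplication 𝕜 F S g)
  {nabla : CovariantDerivative I E (TangentSpace I : M → Type _)}
  (D DC : SpinorConnection 𝕜 I F S)
  {ι : Type*} [Fintype ι] [DecidableEq ι] (e : ∀ x : M, Basis ι ℝ (TangentSpace I x))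
  {f h : Π x, ExteriorAlgebra 𝕜 (S x)} {x : M}

/-- Near `x`, the field `ı(φ)` may be computed in the frame `localFrame I e x`. -/
theorem iota_eventuallyEq (φ : Π x, S x) (f : Π x, ExteriorAlgebra 𝕜 (S x)) (x : M) :
    ∀ᶠ y in 𝓝 x, iota γ D e φ f y
      = ∑ ν, ExteriorAlgebra.ι 𝕜 (γ.val y (g.raise (localFrame I e x y) ν) (φ y))
          * superD D f y (localExt ℝ E (e x ν) y) := by
  filter_upwards [(trivializationAt E (TangentSpace I : M → Type _) x).open_baseSet.mem_nhds
    (FiberBundle.mem_baseSet_trivializationAt' x)] with y hy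
  simp only [← localFrame_apply e hy]
  exact g.contraction_eq (e y) (localFrame I e x y)
    (fun v => ExteriorAlgebra.ι 𝕜 (γ.val y v (φ y))) (superD D f y)
    (ι_clifford_sum_smul γ y (φ y)) (superD_sum_vec D f y Finset.univ)

theorem contMDiffAt_localFrame (x : M) (μ : ι) :
    ContMDiffAt I (I.prod 𝓘(ℝ, E)) ∞ (fun y ↦ TotalSpace.mk' E y (localFrame I e x y μ)) x :=
  (contMDiffOn_localFrame e x μ).contMDiffAt
    ((trivializationAt E (TangentSpace I : M → Type _) x).open_baseSet.mem_nhds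
      (FiberBundle.mem_baseSet_trivializationAt' x))

theorem smoothSuperAt_superD_localExt (hf : IsSuperfunction I F f) (v : TangentSpace I x) :
    SmoothSuperAt I F (fun y => superD D f y (localExt ℝ E v y)) x :=
  smoothSuperAt_superD D (trivializationAt E (TangentSpace I : M → Type _) x).open_baseSet
    (fun y _ => isSuperfunction_iff.1 hf y) (contMDiffOn_localExt x v)
    (FiberBundle.mem_baseSet_trivializationAt' x)

theorem contMDiffAt_clifford_raise (φ : ContMDiffSection I F ∞ S) (x : M) (ν : ι) :
    ContMDiffAt I (I.prod 𝓘(ℝ, F)) ∞ (fun y ↦ TotalSpace.mk' F y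
      (γ.val y (g.raise (localFrame I e x y) ν) (φ y))) x :=
  contMDiffAt_clifford_section γ
    (contMDiffAt_raise g (localFrame I e x) (contMDiffAt_localFrame e x) ν)
    (φ.contMDiff x)

theorem isSuperfunction_iota (φ : ContMDiffSection I F ∞ S) (hf : IsSuperfunction I F f) :
    IsSuperfunction I F (iota γ D e φ f) := by
  rw [isSuperfunction_iff]
  intro x
  refine SmoothSuperAt.congr ?_ (iota_eventuallyEq γ D e φ f x)
  exact SmoothSuperAt.sum _ fun ν _ =>
    (SmoothSuperAt.of_section (contMDiffAt_clifford_raise γ e φ x ν)).mul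
      (smoothSuperAt_superD_localExt D hf (e x ν))

theorem isSuperVectorField_iota (φ : ContMDiffSection I F ∞ S) :
    IsSuperVectorField I F 1 (iota γ D e φ) where
  smooth f hf := isSuperfunction_iota γ D e φ hf
  map_add f h hf hh := by
    funext x
    simp only [iota, Pi.add_apply, superD_add D (hf x) (hh x), mul_add, Finset.sum_add_distrib]
  map_smul c f hf := by
    funext x
    simp only [iota, Pi.smul_apply, superD_const_smul D c (hf x), mul_smul_comm, Finset.smul_sum]
  parity q f hf hq x := Submodule.sum_mem _ fun μ _ =>
    mul_mem_evenOdd (ι_mem_evenOdd _) (superD_mem_evenOdd D (hf x) hq _)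
  leibniz q f h hf hq hh := by
    funext x
    simp only [iota, Pi.add_apply, Pi.mul_apply, Pi.smul_apply, superD_mul D (hf x) (hh x),
      Finset.sum_mul, Finset.mul_sum, Finset.smul_sum, mul_add, Finset.sum_add_distrib]
    congr 1
    · simp only [mul_assoc]
    · refine Finset.sum_congr rfl fun μ _ => ?_
      rw [← mul_assoc, ι_mul_of_mem_evenOdd _ (hq x), smul_mul_assoc, mul_assoc,
        show (1 : ZMod 2).val = 1 from rfl, one_mul]

theorem nabla_localFrame (μ : ι) (v : TangentSpace I x) :
    nabla (fun y => localFrame I e x y μ) x v = nabla (localExt ℝ E (e x μ)) x v := by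
  have h : ∀ᶠ y in 𝓝 x, localFrame I e x y μ = localExt ℝ E (e x μ) y := by
    filter_upwards [(trivializationAt E (TangentSpace I : M → Type _) x).open_baseSet.mem_nhds
      (FiberBundle.mem_baseSet_trivializationAt' x)] with y hy using localFrame_apply e hy μ
  rw [show nabla (fun y => localFrame I e x y μ) x = _ from
    nabla.isCovariantDerivativeOnUniv.congr_of_eventuallyEq
      ((contMDiffAt_localFrame e x μ).mdifferentiableAt (by simp))
      (mdifferentiableAt_localExt ℝ E (e x μ)) Filter.univ_mem h]

/-- The second covariant derivative of a superfunction. -/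
def hessian (nabla : CovariantDerivative I E (TangentSpace I : M → Type _))
    (D : SpinorConnection 𝕜 I F S) (f : Π x, ExteriorAlgebra 𝕜 (S x)) (x : M)
    (u v : TangentSpace I x) : ExteriorAlgebra 𝕜 (S x) :=
  superD D (fun y => superD D f y (localExt ℝ E v y)) x u
    - superD D f x (nabla (localExt ℝ E v) x u)

theorem hessian_sub_hessian (hnabla : IsLeviCivita g nabla) (hf : IsSuperfunction I F f)
    (u v : TangentSpace I x) :
    hessian nabla D f x u v - hessian nabla D f x v u = derivOfEnd (curvature D x u v) (f x) := by
  have h₁ := superD_commutator D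
    (trivializationAt E (TangentSpace I : M → Type _) x).open_baseSet
    (fun y _ => isSuperfunction_iff.1 hf y) (FiberBundle.mem_baseSet_trivializationAt' x) u v
    (contMDiffOn_localExt x u) (contMDiffOn_localExt x v)
  have h₂ := hnabla.torsion_free x _ _ (mdifferentiableAt_localExt ℝ E u)
    (mdifferentiableAt_localExt ℝ E v)
  rw [localExt_self, localExt_self, sub_eq_iff_eq_add] at h₂
  have h₃ := superD_add_vec D f x (VectorField.mlieBracket I (localExt ℝ E u) (localExt ℝ E v) x)
    (nabla (localExt ℝ E u) x v)
  rw [← h₂] at h₃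
  rw [hessian, hessian, h₃, sub_sub_sub_comm, h₁]
  abel

theorem superD_iota (hnabla : IsLeviCivita g nabla) (hf : IsSuperfunction I F f)
    {η : ContMDiffSection I F ∞ S} (u : TangentSpace I x) (hη : DC.toFun η x u = 0) :
    superD D (iota γ D e η f) x u
      = ∑ ν, (ExteriorAlgebra.ι 𝕜 (hatDgamma γ nabla D DC x u (g.raise (e x) ν) (η x))
            * superD D f x (e x ν)
          + ExteriorAlgebra.ι 𝕜 (γ.val x (g.raise (e x) ν) (η x))
            * hessian nabla D f x u (e x ν)) := by
  have hP := contMDiffAt_clifford_raise γ e η x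
  have hG := fun ν => smoothSuperAt_superD_localExt (x := x) D hf (e x ν)
  have hderiv : ∀ ν, D.toFun (fun y => γ.val y (g.raise (localFrame I e x y) ν) (η y)) x u
      = hatDgamma γ nabla D DC x u (g.raise (e x) ν) (η x)
        - ∑ l, (g.val x (g.raise (e x) ν) (nabla (localExt ℝ E (e x l)) x u) : 𝕜)
          • γ.val x (g.raise (e x) l) (η x) := by
    intro ν
    have h₁ := hatDgamma_apply γ nabla D DC u
      ((contMDiffAt_raise g (localFrame I e x) (contMDiffAt_localFrame e x) ν).mdifferentiableAt
        (by simp)) ((η.contMDiff x).mdifferentiableAt (by simp))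
    rw [hη, hnabla.nabla_raise (localFrame I e x) (contMDiffAt_localFrame e x)] at h₁
    simp only [nabla_localFrame, localFrame_self, map_zero, sub_zero, map_neg, neg_apply,
      sub_neg_eq_add] at h₁
    rw [h₁]
    simp only [map_sum, _root_.map_smul, sum_apply, smul_apply, ofReal_smul_fibre 𝕜 F x,
      add_sub_cancel_right]
  have hsum := superD_sum D Finset.univ
    (fun ν _ => (SmoothSuperAt.of_section (𝕜 := 𝕜) (hP ν)).mul (hG ν)) u
  simp only [Pi.mul_def] at hsum
  rw [superD_congr D (iota_eventuallyEq γ D e η f x), hsum]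
  have hterm : ∀ ν, superD D (fun y => ExteriorAlgebra.ι 𝕜
        (γ.val y (g.raise (localFrame I e x y) ν) (η y)) * superD D f y (localExt ℝ E (e x ν) y)) x u
      = ExteriorAlgebra.ι 𝕜 (hatDgamma γ nabla D DC x u (g.raise (e x) ν) (η x))
            * superD D f x (e x ν)
        - (∑ l, (g.val x (g.raise (e x) ν) (nabla (localExt ℝ E (e x l)) x u) : 𝕜)
          • (ExteriorAlgebra.ι 𝕜 (γ.val x (g.raise (e x) l) (η x)) * superD D f x (e x ν)))
        + ExteriorAlgebra.ι 𝕜 (γ.val x (g.raise (e x) ν) (η x))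
            * superD D (fun y => superD D f y (localExt ℝ E (e x ν) y)) x u := by
    intro ν
    refine (superD_mul D (SmoothSuperAt.of_section (hP ν)) (hG ν) u).trans ?_
    rw [superD_ι D (hP ν), hderiv]
    simp only [localExt_self, localFrame_self, map_sub, sub_mul, map_sum, _root_.map_smul,
      Finset.sum_mul, smul_mul_assoc]
  have hvec : ∀ l, superD D f x (nabla (localExt ℝ E (e x l)) x u)
      = ∑ ν, (g.val x (g.raise (e x) ν) (nabla (localExt ℝ E (e x l)) x u) : 𝕜)
        • superD D f x (e x ν) := by
    intro l
    rw [← superD_sum_vec, g.sum_raise_smul]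
  simp only [hterm, hessian, hvec, mul_sub, Finset.mul_sum, mul_smul_comm, Finset.sum_add_distrib,
    Finset.sum_sub_distrib]
  rw [Finset.sum_comm (f := fun ν l =>
    (g.val x (g.raise (e x) ν) (nabla (localExt ℝ E (e x l)) x u) : 𝕜)
          • (ExteriorAlgebra.ι 𝕜 (γ.val x (g.raise (e x) l) (η x)) * superD D f x (e x ν)))]
  abel

theorem iota_iota {K : Set (ContMDiffSection I F ∞ S)} (hnabla : IsLeviCivita g nabla)
    (hadm : IsAdmissible γ nabla D DC K) (hf : IsSuperfunction I F f)
    (φ : Π x, S x) {ψ : ContMDiffSection I F ∞ S} (hψ : ψ ∈ K)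
    (hpar : ∀ v : TangentSpace I x, DC.toFun ψ x v = 0) :
    iota γ D e φ (iota γ D e ψ f) x
      = (1 / 2 : 𝕜) • ∑ μ, ∑ ν, ExteriorAlgebra.ι 𝕜 (γ.val x (g.raise (e x) μ) (φ x))
          * ExteriorAlgebra.ι 𝕜 (torsion γ nabla D DC x (e x μ) (e x ν) (ψ x))
          * superD D f x (g.raise (e x) ν)
        + ∑ μ, ∑ ν, ExteriorAlgebra.ι 𝕜 (γ.val x (g.raise (e x) μ) (φ x))
          * ExteriorAlgebra.ι 𝕜 (γ.val x (g.raise (e x) ν) (ψ x))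
          * hessian nabla D f x (e x μ) (e x ν) := by
  rw [iota, Finset.smul_sum, ← Finset.sum_add_distrib]
  refine Finset.sum_congr rfl fun μ _ => ?_
  have hflip := g.contraction_flip (e x)
    (fun v => ExteriorAlgebra.ι 𝕜 (torsion γ nabla D DC x (e x μ) v (ψ x))) (superD D f x)
    (ι_torsion_sum_smul γ nabla D DC x (e x μ) (ψ x)) (superD_sum_vec D f x Finset.univ)
  rw [superD_iota γ D DC e hnabla hf _ (hpar _), Finset.sum_add_distrib, mul_add]
  simp only [hatDgamma_eq_half_torsion γ nabla D DC hadm hψ, _root_.map_smul, smul_mul_assoc,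
    ← Finset.smul_sum, hflip, mul_smul_comm, Finset.mul_sum, mul_assoc]

end SuperVectorField

end SpinorSuper

end

theorem proposition4p14 {𝕜 : Type*} [RCLike 𝕜]
    -- the manifold `M`
    {E : Type*} [NormedAddCommGroup E] [NormedSpace ℝ E] [FiniteDimensional ℝ E]
    {H : Type*} [TopologicalSpace H] {I : ModelWithCorners ℝ E H}
    {M : Type*} [TopologicalSpace M] [ChartedSpace H M] [IsManifold I ∞ M]
    [BoundarylessManifold I M]
    -- the real (`𝕜 = ℝ`) or complex (`𝕜 = ℂ`) smooth vector bundle `S`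
    {F : Type*} [NormedAddCommGroup F] [NormedSpace ℝ F] [NormedSpace 𝕜 F] [IsScalarTower ℝ 𝕜 F]
    [FiniteDimensional 𝕜 F]
    {S : M → Type*} [TopologicalSpace (TotalSpace F S)]
    [∀ x, AddCommGroup (S x)] [∀ x, Module ℝ (S x)] [∀ x, Module 𝕜 (S x)]
    [∀ x, TopologicalSpace (S x)] [∀ x, IsTopologicalAddGroup (S x)]
    [∀ x, ContinuousSMul ℝ (S x)]
    [FiberBundle F S] [VectorBundle ℝ F S] [VectorBundle 𝕜 F S] [ContMDiffVectorBundle ∞ F S I]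
    -- metric, Levi-Civita connection, Clifford multiplication, charge conjugation
    (g : PseudoRiemannianMetric I M)
    (nabla : CovariantDerivative I E (TangentSpace I : M → Type _)) (hnabla : IsLeviCivita g nabla)
    (γ : CliffordMultiplication 𝕜 F S g) (C : ChargeConjugation 𝕜 γ)
    -- the connection `D` and its associated connection `D^C`
    (D DC : SpinorConnection 𝕜 I F S) (hDC : IsChargeAdjoint C D DC)
    -- an admissible linear space of `D^C`-parallel spinors
    (K : Submodule ℝ (ContMDiffSection I F ∞ S))
    (hpar : ∀ φ ∈ K, ∀ (x : M) (v : TangentSpace I x), DC.toFun φ x v = 0)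
    (hadm : IsAdmissible γ nabla D DC (K : Set (ContMDiffSection I F ∞ S)))
    -- a basis of each tangent space, for instance the values of a local frame
    {ι : Type*} [Fintype ι] [DecidableEq ι] (e : ∀ x : M, Basis ι ℝ (TangentSpace I x)) :
    (∀ φ ∈ K, IsSuperVectorField I F 1 (iota γ D e φ)) ∧
    ∀ φ ∈ K, ∀ ψ ∈ K, ∀ f : (Π x, ExteriorAlgebra 𝕜 (S x)), IsSuperfunction I F f →
      superBracket 1 1 (iota γ D e φ) (iota γ D e ψ) f
        = curvatureTerm γ (curvature D) e φ ψ f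
          + (1 / 2 : 𝕜) • torsionTerm γ D (torsion γ nabla D DC) e φ ψ f := by
  refine ⟨fun φ _ => isSuperVectorField_iota γ D e φ, fun φ hφ ψ hψ f hf => ?_⟩
  funext x
  have h₁ := iota_iota γ D DC e hnabla hadm hf φ hψ (hpar ψ hψ x)
  have h₂ := iota_iota γ D DC e hnabla hadm hf ψ hφ (hpar φ hφ x)
  have hswap : ∑ μ, ∑ ν, ExteriorAlgebra.ι 𝕜 (γ.val x (g.raise (e x) μ) (ψ x))
          * ExteriorAlgebra.ι 𝕜 (γ.val x (g.raise (e x) ν) (φ x))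
          * hessian nabla D f x (e x μ) (e x ν)
      = -∑ μ, ∑ ν, ExteriorAlgebra.ι 𝕜 (γ.val x (g.raise (e x) μ) (φ x))
          * ExteriorAlgebra.ι 𝕜 (γ.val x (g.raise (e x) ν) (ψ x))
          * hessian nabla D f x (e x ν) (e x μ) := by
    rw [Finset.sum_comm]
    simp only [← Finset.sum_neg_distrib]
    refine Finset.sum_congr rfl fun μ _ => Finset.sum_congr rfl fun ν _ => ?_
    rw [ι_anticomm, neg_mul]
  simp only [superBracket, curvatureTerm, torsionTerm, Pi.sub_apply, Pi.add_apply, Pi.smul_apply,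
    Pi.neg_apply, show (1 : ZMod 2).val = 1 from rfl, mul_one, pow_one, neg_smul, one_smul,
    sub_neg_eq_add, h₁,
    h₂, hswap, ← hessian_sub_hessian D hnabla hf, mul_sub, add_mul, Finset.sum_sub_distrib,
    Finset.sum_add_distrib, smul_add]
  abel
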